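/- Let $G$ be $U(1)$ (with $N=1$) or $SU(2)$ (with $N=2$), let $M$ be a finite-dimensional real analytic manifold (Hausdorff, second countable, without boundary), let $P$ be a smooth principal $G$-bundle over $M$, and fix $u_0\in P$ lying over $\star\in M$. Let $\mathcal A$ be the set of smooth principal connections on $P$. For a continuous, piecewise analytic loop $\alpha$ in $M$ based at $\star$ and $A\in\mathcal A$, the holonomy $H_A(\alpha)\in G$ is defined by $u_0=\mathcal P^A_\alpha(u_0)\,H_A(\alpha)$, where $\mathcal P^A_\alpha(u_0)$ is the end point of the $A$-horizontal lift of $\alpha$ starting at $u_0$. The Wilson function of $\alpha$ is the bounded gauge-invariant function $T_\alpha(A)=\frac1N\operatorname{Tr}H_A(\alpha)$ on $\mathcal A$, and $\mathcal W=\{T_\alpha\}$ is the set of all Wilson functions. Let $\mathrm{Hol}(M,G)$ be the commutative unital $C^*$-algebra generated by $\mathcal W$ in the algebra of bounded complex functions on $\mathcal A$ with the supremum norm, let $\overline{\mathcal A/\mathcal G}$ be its Gelfand spectrum (a compact Hausdorff space), and write $T_\alpha(\bar A)=\bar A(T_\alpha)$ for $\bar A\in\overline{\mathcal A/\mathcal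 G}$. Let $M(\overline{\mathcal A/\mathcal G})$ be the space of complex regular Borel measures on $\overline{\mathcal A/\mathcal G}$ with the total variation norm, $M_+(\overline{\mathcal A/\mathcal G})$ its cone of positive measures, and $\mathcal B(\mathcal W)$ the space of bounded complex functions on $\mathcal W$ with the supremum norm. A function $\ell:\mathcal W\to\mathbb C$ is called positive definite if, for all $n$, all $c_1,\dots,c_n\in\mathbb C$ and all $T_{\alpha_1},\dots,T_{\alpha_n}\in\mathcal W$, one has $\sum_{i=1}^n c_i\,\ell(T_{\alpha_i})\ge 0$ whenever $\sum_{i=1}^n c_i\,T_{\alpha_i}(\bar A)\ge 0$ for every $\bar A\in\overline{\mathcal A/\mathcal G}$ (here $z\ge0$ means that $z$ is real and non-negative); $\mathcal P(\mathcal W)$ denotes the set of these functions. For $\mu\in M(\overline{\mathcal A/\mathcal G})$ put $$\ell_\mu(T_\alpha)=\int_{\overline{\mathcal A/\mathcal G}}\overline{T_\alpha(\bar A)}\,d\mu(\bar A).$$ Then: 1. $\mathcal L:\mu\mapsto\ell_\mu$ is a well-defined, continuous, injective linear map $M(\overline{\mathcal A/\mathcal G})\to\mathcal B(\mathcal W)$.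 2. The restriction of $\mathcal L$ to $M_+(\overline{\mathcal A/\mathcal G})$ is a bijection onto $\mathcal P(\mathcal W)$. -/

import Mathlib

open Set MeasureTheory
open scoped Manifold ContDiff ENNReal ComplexOrder

noncomputable section

namespace LoopTransform

/-! ### Structure groups -/

/-- The group `SU(N)`, as a subgroup of `U(N)`. -/
def SU (N : ℕ) : Subgroup (Matrix.unitaryGroup (Fin N) ℂ) :=
  MonoidHom.ker (Matrix.detMonoidHom.comp (Matrix.unitaryGroup (Fin N) ℂ).subtype)

/-- `G` is one of the two gauge groups `U(1)` and `SU(2)`. -/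
inductive IsU1OrSU2 : ∀ {N : ℕ}, Subgroup (Matrix.unitaryGroup (Fin N) ℂ) → Prop
  | u1 : IsU1OrSU2 (N := 1) ⊤
  | su2 : IsU1OrSU2 (SU 2)

/-- The underlying matrix of an element of `G ≤ U(N)`. -/
def mat {N : ℕ} {G : Subgroup (Matrix.unitaryGroup (Fin N) ℂ)} (g : G) :
    Matrix (Fin N) (Fin N) ℂ :=
  ((g : Matrix.unitaryGroup (Fin N) ℂ) : Matrix (Fin N) (Fin N) ℂ)

/-- The Lie algebra of a matrix group `G ≤ U(N)`. -/
def lieAlg {N : ℕ} (G : Subgroup (Matrix.unitaryGroup (Fin N) ℂ)) :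
    Set (Matrix (Fin N) (Fin N) ℂ) :=
  {X | ∀ t : ℝ, ∃ g : G, mat g = NormedSpace.exp (t • X)}

/-! ### Principal bundles and connections -/

/-- A smooth principal `G`-bundle with total space `P` over `M`: a right action of `G` on `P` whose
orbits are the fibres of `proj` and which is free, together with an atlas of equivariant local
trivializations `p ↦ (proj p, coord i p)` from `proj ⁻¹' dom i` to `dom i × G`, whose transition
functions are smooth. The topology and the smooth structure of `P` are those that make these
trivializations diffeomorphisms. -/
structure PrincipalBundle {N : ℕ} (G : Subgroup (Matrix.unitaryGroup (Fin N) ℂ))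
    (E : Type*) [NormedAddCommGroup E] [NormedSpace ℝ E]
    (M : Type*) [TopologicalSpace M] [ChartedSpace E M] (P : Type*) where
  proj : P → M
  proj_surjective : Function.Surjective proj
  act : P → G → P
  act_one : ∀ p, act p 1 = p
  act_mul : ∀ p g h, act p (g * h) = act (act p g) h
  proj_act : ∀ p g, proj (act p g) = proj p
  existsUnique_act : ∀ p q, proj p = proj q → ∃! g, act p g = q
  /-- index type of the atlas of local trivializations -/
  ι : Type*
  dom : ι → Set M
  isOpen_dom : ∀ i, IsOpen (dom i)
  cover : ∀ x, ∃ i, x ∈ dom i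
  coord : ι → P → G
  coord_act : ∀ i p g, proj p ∈ dom i → coord i (act p g) = coord i p * g
  /-- transition functions -/
  trans : ι → ι → M → G
  coord_eq : ∀ i j p, proj p ∈ dom i → proj p ∈ dom j →
    coord i p = trans i j (proj p) * coord j p
  smooth_trans : ∀ i j k l,
    ContMDiffOn 𝓘(ℝ, E) 𝓘(ℝ, ℂ) ∞ (fun x => mat (trans i j x) k l) (dom i ∩ dom j)

section

variable {N : ℕ} {G : Subgroup (Matrix.unitaryGroup (Fin N) ℂ)}
  {E : Type*} [NormedAddCommGroup E] [NormedSpace ℝ E]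
  {M : Type*} [TopologicalSpace M] [ChartedSpace E M] [IsManifold 𝓘(ℝ, E) ω M] {P : Type*}

/-- A smooth principal connection, given by its local connection forms: `form i` is the pull-back
to `dom i`, along the section on which `coord i = 1`, of the connection form on `P`. It is a smooth
`1`-form on `dom i` with values in the Lie algebra of `G`, and on overlaps
`Aⱼ = gᵢⱼ⁻¹ Aᵢ gᵢⱼ + gᵢⱼ⁻¹ dgᵢⱼ`. A `1`-form is smooth iff it is smooth as a function on the tangent
bundle. Outside `dom i` the form `form i` is set to zero, so that a connection is determined by its
local forms and conversely. -/
structure Connection (B : PrincipalBundle G E M P) where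
  form : B.ι → ∀ x : M, TangentSpace 𝓘(ℝ, E) x →ₗ[ℝ] Matrix (Fin N) (Fin N) ℂ
  form_mem : ∀ i, ∀ x ∈ B.dom i, ∀ v, form i x v ∈ lieAlg G
  smooth_form : ∀ i k l,
    ContMDiffOn (𝓘(ℝ, E)).tangent 𝓘(ℝ, ℂ) ∞
      (fun p : TangentBundle 𝓘(ℝ, E) M => form i p.1 p.2 k l)
      (Bundle.TotalSpace.proj ⁻¹' B.dom i)
  form_trans : ∀ i j, ∀ x ∈ B.dom i, x ∈ B.dom j → ∀ v : TangentSpace 𝓘(ℝ, E) x,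
    form j x v =
      mat (B.trans i j x)⁻¹ * form i x v * mat (B.trans i j x)
        + mat (B.trans i j x)⁻¹ * Matrix.of (fun k l =>
            (mfderiv 𝓘(ℝ, E) 𝓘(ℝ, ℂ) (fun y => mat (B.trans i j y) k l) x v : ℂ))
  form_off : ∀ i, ∀ x ∉ B.dom i, form i x = 0

/-! ### Loops and holonomy -/

variable (E) in
/-- A (parametrized) continuous piecewise analytic loop in `M` based at `x₀`, on an interval
`[a, b]`; the values of `toFun` outside `[a, b]` are irrelevant. -/
structure PLoop (x₀ : M) where
  toFun : ℝ → M
  a : ℝ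
  b : ℝ
  le : a ≤ b
  continuousOn : ContinuousOn toFun (Icc a b)
  piecewise_analytic : ∃ (n : ℕ) (t : ℕ → ℝ), Monotone t ∧ t 0 = a ∧ t n = b ∧
    ∀ i < n, ContMDiffOn 𝓘(ℝ, ℝ) 𝓘(ℝ, E) ω toFun (Icc (t i) (t (i + 1)))
  source : toFun a = x₀
  target : toFun b = x₀

/-- `u` is a horizontal lift of the loop `γ` for the connection `A`: it is continuous and, off a
finite set of parameters, its coordinate `h` in the `i`-th local trivialization solves
`h' = - Aᵢ(γ') h`. -/
def IsHorizontalLift {B : PrincipalBundle G E M P} (A : Connection B) {x₀ : M} (γ : PLoop E x₀)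
    (u : ℝ → P) : Prop :=
  (∀ t ∈ Icc γ.a γ.b, B.proj (u t) = γ.toFun t) ∧
  (∀ i k l, ContinuousOn (fun t => mat (B.coord i (u t)) k l)
    (Icc γ.a γ.b ∩ γ.toFun ⁻¹' B.dom i)) ∧
  ∃ S : Set ℝ, S.Finite ∧ ∀ t ∈ Ioo γ.a γ.b \ S, ∀ i, γ.toFun t ∈ B.dom i → ∀ k l,
    HasDerivAt (fun s => mat (B.coord i (u s)) k l)
      (-(A.form i (γ.toFun t) (mfderiv 𝓘(ℝ, ℝ) 𝓘(ℝ, E) γ.toFun t (1 : ℝ))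
        * mat (B.coord i (u t))) k l) t

/-- The holonomy `H_A(γ) ∈ G` with respect to `u₀`, defined by `u₀ = P_γ(u₀) · H_A(γ)`, where the
parallel transport `P_γ(u₀)` is the end point of the horizontal lift of `γ` starting at `u₀`. -/
def holonomy {B : PrincipalBundle G E M P} (A : Connection B) (u₀ : P)
    (γ : PLoop E (B.proj u₀)) : G :=
  Classical.epsilon fun g : G =>
    ∃ u : ℝ → P, IsHorizontalLift A γ u ∧ u γ.a = u₀ ∧ u₀ = B.act (u γ.b) g

/-! ### Wilson functions, the holonomy C*-algebra and its spectrum -/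

lemma norm_trace_le (g : G) : ‖(1 / (N : ℂ)) * (mat g).trace‖ ≤ ‖(1 / (N : ℂ))‖ * N := by
  rw [norm_mul]
  gcongr
  calc ‖(mat g).trace‖ ≤ ∑ i : Fin N, ‖mat g i i‖ := norm_sum_le _ _
    _ ≤ ∑ _i : Fin N, (1 : ℝ) :=
        Finset.sum_le_sum fun i _ =>
          entry_norm_bound_of_unitary (g : Matrix.unitaryGroup (Fin N) ℂ).2 i i
    _ = N := by simp

/-- The discrete topology on the space of connections. It serves only to regard all bounded
functions on this space as bounded continuous functions. -/
instance (B : PrincipalBundle G E M P) : TopologicalSpace (Connection B) := ⊥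

instance (B : PrincipalBundle G E M P) : DiscreteTopology (Connection B) := ⟨rfl⟩

/-- The C*-algebra of all bounded complex functions on the space of connections, with the
supremum norm. -/
abbrev BddFun (B : PrincipalBundle G E M P) : Type _ :=
  BoundedContinuousFunction (Connection B) ℂ

/-- The Wilson function `T_γ(A) = (1/N) Tr H_A(γ)`. -/
def wilson (B : PrincipalBundle G E M P) (u₀ : P) (γ : PLoop E (B.proj u₀)) : BddFun B :=
  BoundedContinuousFunction.ofNormedAddCommGroupDiscrete
    (fun A => (1 / (N : ℂ)) * (mat (holonomy A u₀ γ)).trace) (‖(1 / (N : ℂ))‖ * N)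
    (fun _ => norm_trace_le _)

/-- The set `𝒲` of all Wilson functions. -/
def wilsonSet (B : PrincipalBundle G E M P) (u₀ : P) : Set (BddFun B) :=
  range (wilson B u₀)

/-- The holonomy C*-algebra `Hol(M, G)`: the closure in the supremum norm of the *-algebra
generated by the Wilson functions. -/
def Hol (B : PrincipalBundle G E M P) (u₀ : P) : StarSubalgebra ℂ (BddFun B) :=
  (StarAlgebra.adjoin ℂ (wilsonSet B u₀)).topologicalClosure

lemma wilsonSet_subset_Hol (B : PrincipalBundle G E M P) (u₀ : P) {f : BddFun B}
    (hf : f ∈ wilsonSet B u₀) : f ∈ Hol B u₀ :=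
  StarSubalgebra.le_topologicalClosure _ (StarAlgebra.subset_adjoin ℂ _ hf)

lemma isClosed_Hol (B : PrincipalBundle G E M P) (u₀ : P) :
    IsClosed (Hol B u₀ : Set (BddFun B)) :=
  StarSubalgebra.isClosed_topologicalClosure _

instance (B : PrincipalBundle G E M P) (u₀ : P) : CompleteSpace (Hol B u₀) :=
  (isClosed_Hol B u₀).completeSpace_coe

/-- The space of generalized connections: the Gelfand spectrum of `Hol(M, G)`. -/
abbrev GenConn (B : PrincipalBundle G E M P) (u₀ : P) : Type _ :=
  WeakDual.characterSpace ℂ (Hol B u₀)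

instance (B : PrincipalBundle G E M P) (u₀ : P) : MeasurableSpace (GenConn B u₀) := borel _

instance (B : PrincipalBundle G E M P) (u₀ : P) : BorelSpace (GenConn B u₀) := ⟨rfl⟩

/-- The value `T(Ā)` of a Wilson function at a generalized connection, i.e. its Gelfand
transform. -/
def evalAt {B : PrincipalBundle G E M P} {u₀ : P} (T : wilsonSet B u₀) (Abar : GenConn B u₀) : ℂ :=
  Abar (⟨T, wilsonSet_subset_Hol B u₀ T.2⟩ : Hol B u₀)

/-- Positive definite functions on `𝒲`. -/
def PosDef (B : PrincipalBundle G E M P) (u₀ : P) : Set (wilsonSet B u₀ → ℂ) :=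
  {ℓ | ∀ (n : ℕ) (c : Fin n → ℂ) (T : Fin n → wilsonSet B u₀),
    (∀ Abar : GenConn B u₀, 0 ≤ ∑ i, c i * evalAt (T i) Abar) → 0 ≤ ∑ i, c i * ℓ (T i)}

end

/-! ### Complex regular measures -/

section Measures

variable {X : Type*} [TopologicalSpace X] [T2Space X] [MeasurableSpace X] [BorelSpace X]

lemma regular_of_le {ρ m : Measure X} [IsFiniteMeasure m] [m.Regular] (h : ρ ≤ m) :
    ρ.Regular := by
  have hfin : IsFiniteMeasure ρ := ⟨(h univ).trans_lt (measure_lt_top m univ)⟩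
  have : ρ.InnerRegularCompactLTTop := by
    constructor
    rintro s ⟨hs, -⟩ r hr
    obtain ⟨K, hKs, hK, hlt⟩ := hs.exists_isCompact_sdiff_lt (μ := m) (measure_ne_top m s)
      (tsub_pos_of_lt hr).ne'
    refine ⟨K, hKs, hK, ?_⟩
    by_contra! hcon
    have h1 : ρ s ≤ ρ K + ρ (s \ K) := by
      rw [add_comm]
      exact (measure_mono (by intro x hx; by_cases hxK : x ∈ K <;> simp [hx, hxK])).trans
        (measure_union_le (s \ K) K)
    have h2 : ρ (s \ K) < ρ s - r := (h _).trans_lt hlt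
    have h3 : ρ K + ρ (s \ K) < r + (ρ s - r) :=
      ENNReal.add_lt_add_of_le_of_lt (measure_ne_top ρ K) hcon h2
    rw [add_tsub_cancel_of_le hr.le] at h3
    exact absurd h1 (not_le.2 h3)
  infer_instance

variable [CompactSpace X]

variable (X) in
/-- The space of complex regular (Borel) measures on a compact Hausdorff space: the complex
measures whose total variation is regular. -/
def RegMeas : Submodule ℂ (ComplexMeasure X) where
  carrier := {μ | μ.variation.Regular}
  zero_mem' := by
    simp only [mem_ofPred_eq, VectorMeasure.variation_zero]
    infer_instance
  add_mem' {μ ν} hμ hν := by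
    simp only [mem_ofPred_eq] at hμ hν ⊢
    have h1 : IsFiniteMeasure μ.variation := inferInstance
    have h2 : IsFiniteMeasure ν.variation := inferInstance
    have : (μ.variation + ν.variation).Regular := inferInstance
    exact regular_of_le VectorMeasure.variation_add_le
  smul_mem' c μ hμ := by
    simp only [mem_ofPred_eq, VectorMeasure.variation_smul] at hμ ⊢
    infer_instance

instance (μ : RegMeas X) : (μ : ComplexMeasure X).variation.Regular := μ.2

instance (μ : RegMeas X) : IsFiniteMeasure (μ : ComplexMeasure X).variation := inferInstance

/-- The total variation norm. -/
instance : Norm (RegMeas X) := ⟨fun μ => (μ : ComplexMeasure X).variation.real univ⟩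

lemma norm_def (μ : RegMeas X) : ‖μ‖ = (μ : ComplexMeasure X).variation.real univ := rfl

lemma normCore : NormedSpace.Core ℂ (RegMeas X) where
  norm_nonneg μ := measureReal_nonneg
  norm_smul c μ := by
    simp [norm_def, VectorMeasure.variation_smul, measureReal_def]
  norm_triangle μ ν := by
    simp only [norm_def, measureReal_def]
    rw [← ENNReal.toReal_add (measure_ne_top _ _) (measure_ne_top _ _)]
    exact ENNReal.toReal_mono (by simp) (VectorMeasure.variation_add_le univ)
  norm_eq_zero_iff μ := by
    simp [norm_def, measureReal_eq_zero_iff]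

instance : NormedAddCommGroup (RegMeas X) := NormedAddCommGroup.ofCore normCore

instance : NormedSpace ℂ (RegMeas X) := NormedSpace.ofCore normCore

variable (X) in
/-- The cone of positive regular measures. -/
def PosMeas : Set (RegMeas X) :=
  {μ | ∀ s, MeasurableSet s → 0 ≤ (μ : ComplexMeasure X) s}

/-- The integral of a complex function against a complex measure. -/
def cintegral (μ : ComplexMeasure X) (f : X → ℂ) : ℂ :=
  μ.integral f (ContinuousLinearMap.mul ℝ ℂ)

end Measures

end LoopTransform

end

noncomputable section

set_option linter.unusedSectionVars false

namespace LoopTransform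

/-! ### Integration of continuous functions against complex measures -/

section Integration

variable {X : Type*} [TopologicalSpace X] [T2Space X] [CompactSpace X] [MeasurableSpace X]
  [BorelSpace X]

/-! The Wilson functions already span a *-algebra. The constant loop gives `1`, loop inversion gives
complex conjugation, and a product of two Wilson functions is again a linear combination of Wilson
functions: `U(1)` traces are multiplicative, and in `SU(2)` one has `tr g · tr h = tr gh + tr gh⁻¹`
(`wilson_mul_mem_span`). So their span is dense in `Hol`, and by Gelfand's theorem the conjugated
Gelfand transforms span a dense subspace of the continuous functions on the spectrum. This rests on
`holonomy_mul` and `holonomy_inv`, hence on existence and uniqueness of horizontal lifts.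

The rest of the functional analysis is abstract (`exists_integral_transform`). Integration is
bounded by the total variation. A regular measure that annihilates a dense subspace vanishes, whence
injectivity. A positive definite function respects all linear relations, so it extends to a positive
functional on the span; as the span contains `1`, the M. Riesz extension theorem and the
Riesz–Markov theorem represent it by a positive regular measure.

One mismatch remains: the transform integrates conjugated Wilson functions, whereas positive
definiteness speaks of unconjugated ones. The two notions agree by `sum_star_evalAt_nonneg_iff`.
Positivity on the spectrum can be tested on actual connections (`genConn_nonneg_iff`), and for every
`A` and finitely many loops some connection `A'` conjugates all their Wilson functions at once. For
`SU(2)` the traces are real and `A' = A`. For `U(1)` one would like `A' = -A`, but on a non-trivial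
bundle this is not a connection. Finitely many arcs are too thin to meet the zeros of a generic
section of the associated line bundle, so there is a smooth section `f` of norm one over them, and
`A` is reflected in `f`: in the gauge `f = 1` over the arcs this is `-A`, and the same formula makes
sense globally (`exists_holonomy_eq_inv`). -/

lemma integrable_continuousMap {ν : Measure X} [IsFiniteMeasure ν] (f : C(X, ℂ)) :
    Integrable (fun x => f x) ν :=
  (BoundedContinuousFunction.mkOfCompact f).integrable ν

lemma cintegral_add (μ : ComplexMeasure X) [IsFiniteMeasure μ.variation] (f g : C(X, ℂ)) :
    cintegral μ (fun x => f x + g x) = cintegral μ f + cintegral μ g :=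
  VectorMeasure.integral_fun_add (integrable_continuousMap f) (integrable_continuousMap g)

/-- The vector-measure integral is built over `ℝ`, so complex homogeneity is extracted from the
pairing: by associativity, letting `c` act on the integrand or on the value of the integral gives
the same bilinear map. -/
lemma cintegral_const_mul (μ : ComplexMeasure X) [IsFiniteMeasure μ.variation] (c : ℂ)
    (f : C(X, ℂ)) :
    cintegral μ (fun x => c * f x) = c * cintegral μ f := by
  have h1 := VectorMeasure.integral_continuousLinearMap_comp (μ := μ)
    (B := ContinuousLinearMap.mul ℝ ℂ) (C := ContinuousLinearMap.mul ℝ ℂ c)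
    (integrable_continuousMap (ν := μ.variation) f)
  have h2 := VectorMeasure.continuousLinearMap_apply_integral (μ := μ)
    (B := ContinuousLinearMap.mul ℝ ℂ) (C := ContinuousLinearMap.mul ℝ ℂ c)
    (integrable_continuousMap (ν := μ.variation) f)
  have h3 : (ContinuousLinearMap.mul ℝ ℂ) ∘L (ContinuousLinearMap.mul ℝ ℂ c) =
      ((ContinuousLinearMap.compL ℝ ℂ ℂ ℂ (ContinuousLinearMap.mul ℝ ℂ c)) ∘L
        (ContinuousLinearMap.mul ℝ ℂ)) := by
    ext
    simp [mul_assoc]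
  rw [h3, ← h2] at h1
  exact h1

lemma cintegral_measure_add (μ ν : ComplexMeasure X) [IsFiniteMeasure μ.variation]
    [IsFiniteMeasure ν.variation] (f : C(X, ℂ)) :
    cintegral (μ + ν) f = cintegral μ f + cintegral ν f :=
  VectorMeasure.integral_add_vectorMeasure (integrable_continuousMap f)
    (integrable_continuousMap f)

lemma cintegral_measure_smul (c : ℂ) (μ : ComplexMeasure X) [IsFiniteMeasure μ.variation]
    (f : C(X, ℂ)) :
    cintegral (c • μ) f = c * cintegral μ f := by
  have h2 := VectorMeasure.continuousLinearMap_apply_integral (μ := μ)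
    (B := ContinuousLinearMap.mul ℝ ℂ) (C := ContinuousLinearMap.mul ℝ ℂ c)
    (integrable_continuousMap (ν := μ.variation) f)
  have hT : ((c • μ).transpose (ContinuousLinearMap.mul ℝ ℂ) : Set X → _) =
      μ.transpose ((ContinuousLinearMap.compL ℝ ℂ ℂ ℂ (ContinuousLinearMap.mul ℝ ℂ c)) ∘L
        (ContinuousLinearMap.mul ℝ ℂ)) := by
    ext s x
    change x * (c * μ s) = c * (x * μ s)
    ring
  have hd := dominatedFinMeasAdditive_cbmApplyMeasure (c • μ)
    (ContinuousLinearMap.mul ℝ ℂ)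
  have hd' := hd
  rw [hT] at hd'
  have h3 : cintegral (c • μ) f = setToFun (c • μ).variation _ hd' f :=
    setToFun_congr_left _ _ hT _
  -- The two integrals have different control measures, `μ.variation` and its multiple by `‖c‖`. The
  -- second is dominated by a finite multiple of the first, which is enough to identify the
  -- extensions from sets to integrable functions.
  have h4 := setToFun_congr_measure_of_integrable (μ := μ.variation) (μ' := (c • μ).variation)
    (‖c‖₊ : ℝ≥0∞) (by simp) (by rw [VectorMeasure.variation_smul]; rfl)
    (dominatedFinMeasAdditive_cbmApplyMeasure μ
      ((ContinuousLinearMap.compL ℝ ℂ ℂ ℂ (ContinuousLinearMap.mul ℝ ℂ c)) ∘L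
        (ContinuousLinearMap.mul ℝ ℂ))) hd' f (integrable_continuousMap f)
  rw [h3, ← h4]
  exact h2.symm

lemma norm_cintegral_le (μ : ComplexMeasure X) [IsFiniteMeasure μ.variation] {f : X → ℂ}
    {C : ℝ} (hf : ∀ x, ‖f x‖ ≤ C) :
    ‖cintegral μ f‖ ≤ C * μ.variation.real univ := by
  refine (VectorMeasure.norm_integral_le_of_norm_le_const (Filter.Eventually.of_forall hf)).trans ?_
  simp

/-- Integration against a complex measure, as a continuous linear functional. -/
def cintegralCLM (μ : ComplexMeasure X) [IsFiniteMeasure μ.variation] : C(X, ℂ) →L[ℂ] ℂ :=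
  LinearMap.mkContinuous
    { toFun := fun f => cintegral μ f
      map_add' := fun f g => cintegral_add μ f g
      map_smul' := fun c f => cintegral_const_mul μ c f }
    (μ.variation.real univ) fun f =>
      (norm_cintegral_le μ f.norm_coe_le_norm).trans_eq (mul_comm _ _)

@[simp]
lemma cintegralCLM_apply (μ : ComplexMeasure X) [IsFiniteMeasure μ.variation] (f : C(X, ℂ)) :
    cintegralCLM μ f = cintegral μ f := rfl

/-- A regular complex measure is determined by the integrals of continuous functions. -/
lemma eq_zero_of_cintegral_eq_zero (μ : ComplexMeasure X) [μ.variation.Regular]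
    (h : ∀ f : C(X, ℂ), cintegral μ f = 0) : μ = 0 := by
  ext s hs : 1
  have hind : cintegral μ (s.indicator fun _ => (1 : ℂ)) = μ s := by
    simpa [cintegral] using VectorMeasure.integral_indicator_const (μ := μ)
      (B := ContinuousLinearMap.mul ℝ ℂ) (1 : ℂ) hs
  have hmem : MemLp (s.indicator fun _ => (1 : ℂ)) 1 μ.variation :=
    memLp_indicator_const 1 hs 1 (Or.inr (measure_ne_top _ _))
  rw [FunLike.coe_zero, Pi.zero_apply, ← norm_le_zero_iff]
  refine le_of_forall_pos_le_add fun ε hε => ?_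
  -- Regularity enters here: the indicator is approximated in `L¹` of the variation by bounded
  -- continuous functions, whose integrals vanish. The `L¹` distance then bounds `‖μ s‖`.
  obtain ⟨g, hg, -⟩ := hmem.exists_boundedContinuous_eLpNorm_sub_le ENNReal.one_ne_top
    (ε := ENNReal.ofReal ε) (by simpa using hε)
  have h0 : cintegral μ (s.indicator fun _ => (1 : ℂ)) - cintegral μ g =
      cintegral μ (s.indicator (fun _ => (1 : ℂ)) - g) :=
    (VectorMeasure.integral_sub (memLp_one_iff_integrable.1 hmem) (g.integrable _)).symm
  have hg0 : cintegral μ g = 0 := h g.toContinuousMap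
  rw [← hind, ← sub_zero (cintegral μ _), ← hg0, h0, zero_add]
  refine VectorMeasure.norm_integral_le_lintegral_norm.trans ?_
  rw [eLpNorm_one_eq_lintegral_enorm] at hg
  simp only [ContinuousLinearMap.opNorm_mul, one_mul, ofReal_norm]
  exact ENNReal.toReal_le_of_le_ofReal hε.le hg

/-- The complex measure given by a finite positive measure. -/
def ofMeasure (ν : Measure X) [IsFiniteMeasure ν] : ComplexMeasure X :=
  ν.toSignedMeasure.toComplexMeasure 0

lemma ofMeasure_apply (ν : Measure X) [IsFiniteMeasure ν] {s : Set X} (hs : MeasurableSet s) :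
    ofMeasure ν s = (ν.real s : ℂ) := by
  rw [ofMeasure, SignedMeasure.toComplexMeasure_apply, Measure.toSignedMeasure_apply_measurable hs]
  rfl

lemma variation_ofMeasure (ν : Measure X) [IsFiniteMeasure ν] : (ofMeasure ν).variation = ν := by
  have h : ∀ s, MeasurableSet s → ‖ofMeasure ν s‖ₑ = ν s := fun s hs => by
    rw [ofMeasure_apply ν hs, ← ofReal_norm, Complex.norm_real, Real.norm_of_nonneg
      measureReal_nonneg, ofReal_measureReal]
  refine le_antisymm (VectorMeasure.variation_le_of_forall_enorm_le fun s hs => (h s hs).le) ?_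
  exact Measure.le_iff.2 fun s hs => (h s hs).symm.le.trans
    (VectorMeasure.enorm_measure_le_variation _ _)

lemma cintegral_ofMeasure (ν : Measure X) [IsFiniteMeasure ν] (f : C(X, ℂ)) :
    cintegral (ofMeasure ν) f = ∫ x, f x ∂ν := by
  have key : ∀ {g : X → ℂ}, Integrable g ν →
      (ofMeasure ν).integral g (ContinuousLinearMap.mul ℝ ℂ) = ∫ x, g x ∂ν := by
    intro g hg
    have hv := variation_ofMeasure ν
    refine hg.induction (P := fun g => (ofMeasure ν).integral g (ContinuousLinearMap.mul ℝ ℂ) =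
      ∫ x, g x ∂ν) ?_ ?_ ?_ ?_
    · intro c s hs _
      have : IsFiniteMeasure (ofMeasure ν).variation := by rw [hv]; infer_instance
      rw [VectorMeasure.integral_indicator_const _ hs, integral_indicator_const _ hs,
        ofMeasure_apply ν hs]
      simp [mul_comm]
    · intro f g _ hf hg h1 h2
      have hf' : (ofMeasure ν).Integrable f := by rwa [VectorMeasure.Integrable, hv]
      have hg' : (ofMeasure ν).Integrable g := by rwa [VectorMeasure.Integrable, hv]
      rw [VectorMeasure.integral_add hf' hg', integral_add' hf hg, h1, h2]
    · refine isClosed_eq ?_ continuous_integral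
      have := VectorMeasure.continuous_integral (μ := ofMeasure ν)
        (B := ContinuousLinearMap.mul ℝ ℂ)
      rwa [hv] at this
    · intro f g hfg _ h
      rw [← integral_congr_ae hfg, ← h]
      exact (VectorMeasure.integral_congr_ae (by rwa [hv])).symm
  exact key (integrable_continuousMap f)

lemma exists_measure_of_mem_posMeas {μ : RegMeas X} (hμ : μ ∈ PosMeas X) :
    ∃ (ν : Measure X) (_ : IsFiniteMeasure ν), (μ : ComplexMeasure X) = ofMeasure ν := by
  set s := ComplexMeasure.re (μ : ComplexMeasure X)
  have hs : 0 ≤[univ] s := by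
    refine VectorMeasure.restrict_le_restrict_of_subset_le _ _ fun i hi _ => ?_
    exact (Complex.le_def.1 (hμ i hi)).1
  refine ⟨s.toMeasureOfZeroLE univ MeasurableSet.univ hs, inferInstance, ?_⟩
  ext i hi : 1
  rw [ofMeasure, SignedMeasure.toMeasureOfZeroLE_toSignedMeasure,
    SignedMeasure.toComplexMeasure_apply]
  exact Complex.ext rfl (Complex.le_def.1 (hμ i hi)).2.symm

lemma integral_nonneg_complex {ν : Measure X} {f : X → ℂ} (hf : ∀ x, 0 ≤ f x) :
    0 ≤ ∫ x, f x ∂ν := by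
  have : f = fun x => ((f x).re : ℂ) := by
    ext x
    exact Complex.ext rfl (by simpa using (Complex.le_def.1 (hf x)).2.symm)
  rw [this, integral_complex_ofReal]
  exact Complex.zero_le_real.2 (integral_nonneg fun x => (Complex.le_def.1 (hf x)).1)

end Integration

/-! ### Positive definite functions and the abstract integral transform -/

section Representation

variable {X : Type*} [TopologicalSpace X] [T2Space X] [CompactSpace X] [MeasurableSpace X]
  [BorelSpace X] {W : Type*}

/-- The functions on `W` that are non-negative on the relations of non-negativity between the
continuous functions `e w`. -/
def PosDefOf (e : W → C(X, ℂ)) : Set (W → ℂ) :=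
  {ℓ | ∀ (n : ℕ) (c : Fin n → ℂ) (T : Fin n → W),
    (∀ x, 0 ≤ ∑ i, c i * e (T i) x) → 0 ≤ ∑ i, c i * ℓ (T i)}

lemma linearCombination_eq_sum_fin {V : Type*} [AddCommGroup V] [Module ℂ V] (g : W → V)
    (c : W →₀ ℂ) :
    Finsupp.linearCombination ℂ g c = ∑ i : Fin c.support.card,
      c (c.support.equivFin.symm i) • g (c.support.equivFin.symm i) := by
  rw [Finsupp.linearCombination_apply, Finsupp.sum, ← Finset.sum_coe_sort,
    ← Equiv.sum_comp c.support.equivFin.symm]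

/-- A finitely supported version of the defining property of `PosDefOf`. -/
lemma PosDefOf.linearCombination_nonneg {e : W → C(X, ℂ)} {ℓ : W → ℂ} (hℓ : ℓ ∈ PosDefOf e)
    (c : W →₀ ℂ) (h : ∀ x, 0 ≤ Finsupp.linearCombination ℂ e c x) :
    0 ≤ Finsupp.linearCombination ℂ ℓ c := by
  rw [linearCombination_eq_sum_fin]
  refine hℓ _ _ _ fun x => ?_
  have := h x
  rw [linearCombination_eq_sum_fin] at this
  simpa using this

/-- A positive definite function extends to a linear functional on the span. -/
lemma PosDefOf.exists_functional {e : W → C(X, ℂ)} {ℓ : W → ℂ} (hℓ : ℓ ∈ PosDefOf e) :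
    ∃ Λ : Submodule.span ℂ (range e) →ₗ[ℂ] ℂ,
      (∀ w, Λ ⟨e w, Submodule.subset_span ⟨w, rfl⟩⟩ = ℓ w) ∧
      ∀ f : Submodule.span ℂ (range e), (∀ x, 0 ≤ (f : C(X, ℂ)) x) → 0 ≤ Λ f := by
  set q : (W →₀ ℂ) →ₗ[ℂ] Submodule.span ℂ (range e) :=
    (Finsupp.linearCombination ℂ e).codRestrict _ fun c => by
      rw [← Finsupp.range_linearCombination]; exact ⟨c, rfl⟩
  have hq : Function.Surjective q := by
    rintro ⟨f, hf⟩
    rw [← Finsupp.range_linearCombination] at hf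
    obtain ⟨c, rfl⟩ := hf
    exact ⟨c, rfl⟩
  -- A relation `∑ c e = 0` is non-negative together with its negative, so positivity alone makes
  -- `ℓ` respect it; nothing linear is assumed of `ℓ`.
  have hker : LinearMap.ker q ≤ LinearMap.ker (Finsupp.linearCombination ℂ ℓ) := by
    intro c hc
    have hc0 : Finsupp.linearCombination ℂ e c = 0 := congrArg Subtype.val hc
    have h1 := PosDefOf.linearCombination_nonneg hℓ c (by simp [hc0])
    have h2 := PosDefOf.linearCombination_nonneg hℓ (-c) (by simp [hc0])
    rw [map_neg, neg_nonneg] at h2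
    exact le_antisymm h2 h1
  refine ⟨((LinearMap.ker q).liftQ _ hker) ∘ₗ
    (q.quotKerEquivOfSurjective hq).symm.toLinearMap, ?_, ?_⟩
  · intro w
    have : (⟨e w, Submodule.subset_span ⟨w, rfl⟩⟩ : Submodule.span ℂ (range e)) =
        q.quotKerEquivOfSurjective hq (Submodule.Quotient.mk (Finsupp.single w 1)) := by
      ext1
      simp [q]
    rw [this]
    simp [-LinearMap.quotKerEquivOfSurjective_apply_mk]
  · intro f hf
    obtain ⟨c, rfl⟩ := hq f
    have : q c = q.quotKerEquivOfSurjective hq (Submodule.Quotient.mk c) := by simp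
    rw [this]
    simpa [-LinearMap.quotKerEquivOfSurjective_apply_mk] using
      PosDefOf.linearCombination_nonneg hℓ c hf

/-- The inclusion of the real continuous functions into the complex ones. -/
def ofRealL (X : Type*) [TopologicalSpace X] [CompactSpace X] : C(X, ℝ) →L[ℝ] C(X, ℂ) :=
  Complex.ofRealCLM.compLeftContinuous ℝ X

lemma ofRealL_apply (f : C(X, ℝ)) (x : X) : ofRealL X f x = (f x : ℂ) := rfl

/-- A positive functional on a subspace of `C(X, ℂ)` that contains `1` is given, on real functions,
by a regular measure. -/
lemma exists_measure_of_positive {V : Submodule ℂ C(X, ℂ)} (hV : (1 : C(X, ℂ)) ∈ V)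
    (Λ : V →ₗ[ℂ] ℂ) (hΛ : ∀ f : V, (∀ x, 0 ≤ (f : C(X, ℂ)) x) → 0 ≤ Λ f) :
    ∃ (ν : Measure X) (_ : IsFiniteMeasure ν), ν.Regular ∧
      ∀ (f : C(X, ℝ)) (hf : ofRealL X f ∈ V), Λ ⟨ofRealL X f, hf⟩ = ((∫ x, f x ∂ν : ℝ) : ℂ) := by
  set D : Submodule ℝ C(X, ℝ) := (V.restrictScalars ℝ).comap (ofRealL X : C(X, ℝ) →ₗ[ℝ] C(X, ℂ))
  set φ : D →ₗ[ℝ] ℝ := Complex.reLm ∘ₗ (Λ.restrictScalars ℝ) ∘ₗ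
    ((ofRealL X : C(X, ℝ) →ₗ[ℝ] C(X, ℂ)).restrict (p := D) (q := V.restrictScalars ℝ)
      fun f hf => hf)
  have hpos : ∀ f : D, 0 ≤ (f : C(X, ℝ)) → 0 ≤ Λ ⟨ofRealL X f, f.2⟩ := fun f hf =>
    hΛ _ fun x => by simpa [ofRealL_apply] using hf x
  let S : PointedCone ℝ C(X, ℝ) := PointedCone.positive ℝ C(X, ℝ)
  -- The constants lie in `D`, so `D` is cofinal, as the M. Riesz extension theorem requires. That
  -- the witness can also be taken non-negative is used below for the imaginary part.
  have hbd : ∀ y : C(X, ℝ), ∃ x : D, 0 ≤ (x : C(X, ℝ)) ∧ 0 ≤ (x : C(X, ℝ)) + y := by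
    intro y
    have hone : ofRealL X (ContinuousMap.const X ‖y‖) ∈ V := by
      have : ofRealL X (ContinuousMap.const X ‖y‖) = (‖y‖ : ℂ) • (1 : C(X, ℂ)) := by
        ext x; simp [ofRealL_apply]
      rw [this]
      exact V.smul_mem _ hV
    refine ⟨⟨ContinuousMap.const X ‖y‖, hone⟩, fun x => norm_nonneg y, fun x => ?_⟩
    have := neg_le_of_abs_le (y.norm_coe_le_norm x)
    change 0 ≤ ‖y‖ + y x
    linarith
  obtain ⟨g, hg, hgpos⟩ := riesz_extension S ⟨D, φ⟩
    (fun x hx => (Complex.le_def.1 (hpos x hx)).1)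
    fun y => (hbd y).imp fun _ => And.right
  let Γ : CompactlySupportedContinuousMap X ℝ →ₚ[ℝ] ℝ := PositiveLinearMap.mk₀
    { toFun := fun f => g f.toContinuousMap
      map_add' := fun f h => g.map_add f.toContinuousMap h.toContinuousMap
      map_smul' := fun c f => g.map_smul c f.toContinuousMap }
    fun f hf => hgpos _ fun x => hf x
  refine ⟨RealRMK.rieszMeasure Γ, inferInstance, inferInstance, fun f hf => ?_⟩
  have hintegral : ∫ x, f x ∂(RealRMK.rieszMeasure Γ) = (Λ ⟨ofRealL X f, hf⟩).re := by
    exact (RealRMK.integral_rieszMeasure Γ ⟨f, HasCompactSupport.of_compactSpace _⟩).trans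
      (hg ⟨f, hf⟩)
  rw [hintegral]
  -- Only the real part of `Λ` was extended. The imaginary part vanishes on `f = (h + f) - h`, a
  -- difference of non-negative elements, on which `Λ` is non-negative and therefore real.
  refine Complex.ext rfl ?_
  obtain ⟨h, h0, h1⟩ := hbd f
  have h2 := (Complex.le_def.1 (hpos h h0)).2
  set f' : D := ⟨f, hf⟩
  have h3 := (Complex.le_def.1 (hpos (h + f') h1)).2
  have h4 : (⟨ofRealL X ((h + f' : D) : C(X, ℝ)), (h + f' : D).2⟩ : V) =
      ⟨ofRealL X h, h.2⟩ + ⟨ofRealL X f, hf⟩ := Subtype.ext (map_add (ofRealL X) _ _)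
  rw [h4, map_add, Complex.add_im, ← h2] at h3
  simpa using h3.symm

/-- Integration of the functions `e w` identifies the regular complex measures with bounded
functions on `W`, and the positive ones with the positive definite functions. -/
theorem exists_integral_transform (e : W → C(X, ℂ)) {C : ℝ} (hC : ∀ w x, ‖e w x‖ ≤ C)
    (hdense : Dense (Submodule.span ℂ (range e) : Set C(X, ℂ)))
    (hone : (1 : C(X, ℂ)) ∈ Submodule.span ℂ (range e))
    (hstar : ∀ w, star (e w) ∈ Submodule.span ℂ (range e)) :
    ∃ L : RegMeas X →L[ℂ] lp (fun _ : W => ℂ) ∞,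
      (∀ μ w, L μ w = cintegral (μ : ComplexMeasure X) (e w)) ∧ Function.Injective L ∧
      BijOn (fun μ => (L μ : W → ℂ)) (PosMeas X) (PosDefOf e) := by
  have hmem : ∀ μ : RegMeas X, Memℓp (fun w => cintegral (μ : ComplexMeasure X) (e w)) ∞ :=
    fun μ => memℓp_infty ⟨_, forall_mem_range.2 fun w => norm_cintegral_le _ (hC w)⟩
  let L₀ : RegMeas X →ₗ[ℂ] lp (fun _ : W => ℂ) ∞ :=
    { toFun := fun μ => ⟨fun w => cintegral (μ : ComplexMeasure X) (e w), hmem μ⟩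
      map_add' := fun μ ν => by
        ext w
        exact cintegral_measure_add (μ : ComplexMeasure X) ν (e w)
      map_smul' := fun c μ => by
        ext w
        exact cintegral_measure_smul c (μ : ComplexMeasure X) (e w) }
  -- If there are no pairs `(w, x)`, nothing forces `C` to be non-negative; hence `max C 0`.
  let L : RegMeas X →L[ℂ] lp (fun _ : W => ℂ) ∞ := L₀.mkContinuous (max C 0) fun μ => by
    refine lp.norm_le_of_forall_le (by positivity) fun w => ?_
    exact norm_cintegral_le _ fun x => (hC w x).trans (le_max_left _ _)
  have hL : ∀ μ w, L μ w = cintegral (μ : ComplexMeasure X) (e w) := fun μ w => rfl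
  have hinj : Function.Injective L := by
    rw [injective_iff_map_eq_zero]
    intro μ hμ
    refine Subtype.ext (eq_zero_of_cintegral_eq_zero _ fun f => ?_)
    have h0 : ∀ f ∈ Submodule.span ℂ (range e), cintegralCLM (μ : ComplexMeasure X) f = 0 := by
      intro f hf
      induction hf using Submodule.span_induction with
      | mem f hf =>
        obtain ⟨w, rfl⟩ := hf
        rw [cintegralCLM_apply, ← hL, hμ]
        rfl
      | zero => exact map_zero _
      | add f g _ _ h1 h2 => rw [map_add, h1, h2, add_zero]
      | smul c f _ h => rw [map_smul, h, smul_zero]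
    have := Continuous.ext_on hdense (cintegralCLM (μ : ComplexMeasure X)).continuous
      continuous_const (g := fun _ => (0 : ℂ)) h0
    exact congrFun this f
  refine ⟨L, hL, hinj, ?_, fun μ _ ν _ h => hinj (lp.ext h), ?_⟩
  · intro μ hμ n c T hT
    obtain ⟨ν, hν, hμν⟩ := exists_measure_of_mem_posMeas hμ
    have hsum : ∑ i, c i * L μ (T i) = cintegralCLM (μ : ComplexMeasure X) (∑ i, c i • e (T i)) := by
      rw [map_sum]
      exact Finset.sum_congr rfl fun i _ => by rw [map_smul]; rfl
    rw [show ∑ i, c i * (fun μ => (L μ : W → ℂ)) μ (T i) = _ from hsum, cintegralCLM_apply, hμν,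
      cintegral_ofMeasure]
    exact integral_nonneg_complex fun x => by simpa using hT x
  · intro ℓ hℓ
    obtain ⟨Λ, hΛ, hpos⟩ := PosDefOf.exists_functional hℓ
    obtain ⟨ν, hfin, hreg, hν⟩ := exists_measure_of_positive hone Λ hpos
    have hmem : ofMeasure ν ∈ RegMeas X := by
      change (ofMeasure ν).variation.Regular
      rwa [variation_ofMeasure]
    refine ⟨⟨ofMeasure ν, hmem⟩, fun s hs => ?_, ?_⟩
    · rw [ofMeasure_apply ν hs]
      exact Complex.zero_le_real.2 measureReal_nonneg
    · ext w
      change cintegral (ofMeasure ν) (e w) = ℓ w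
      have hw : e w ∈ Submodule.span ℂ (range e) := Submodule.subset_span ⟨w, rfl⟩
      -- The measure represents `Λ` on real functions only. The real and imaginary parts of `e w`
      -- stay in the span because `star (e w)` does.
      let r : C(X, ℝ) := ⟨fun x => (e w x).re, by fun_prop⟩
      let s : C(X, ℝ) := ⟨fun x => (e w x).im, by fun_prop⟩
      have hr : ofRealL X r = (1 / 2 : ℂ) • (e w + star (e w)) := by
        ext x
        have := Complex.add_conj (e w x)
        simp only [ofRealL_apply, ContinuousMap.smul_apply, ContinuousMap.add_apply,
          ContinuousMap.star_apply, RCLike.star_def, this, r, ContinuousMap.coe_mk, smul_eq_mul]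
        push_cast; ring
      have hs : ofRealL X s = (1 / (2 * Complex.I) : ℂ) • (e w - star (e w)) := by
        ext x
        have := Complex.sub_conj (e w x)
        simp only [ofRealL_apply, ContinuousMap.smul_apply, ContinuousMap.sub_apply,
          ContinuousMap.star_apply, RCLike.star_def, this, s, ContinuousMap.coe_mk, smul_eq_mul]
        push_cast
        field_simp
      have hr' : ofRealL X r ∈ Submodule.span ℂ (range e) := by
        rw [hr]; exact Submodule.smul_mem _ _ (Submodule.add_mem _ hw (hstar w))
      have hs' : ofRealL X s ∈ Submodule.span ℂ (range e) := by
        rw [hs]; exact Submodule.smul_mem _ _ (Submodule.sub_mem _ hw (hstar w))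
      have hdec : (⟨e w, hw⟩ : Submodule.span ℂ (range e)) =
          ⟨ofRealL X r, hr'⟩ + Complex.I • ⟨ofRealL X s, hs'⟩ := by
        ext x
        simp [ofRealL_apply, r, s, mul_comm Complex.I, Complex.re_add_im]
      have hdec' : (⇑(e w) : X → ℂ) = fun x => ((r x : ℂ) + (s x : ℂ) * Complex.I) := by
        ext x; simp [r, s, Complex.re_add_im]
      rw [← hΛ w, hdec, map_add, map_smul, hν r hr', hν s hs', cintegral_ofMeasure, hdec',
        integral_add, integral_mul_const, integral_complex_ofReal, integral_complex_ofReal,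
        smul_eq_mul, mul_comm]
      · exact integrable_continuousMap (ofRealL X r)
      · exact (integrable_continuousMap (ofRealL X s)).mul_const _

end Representation

/-! ### The matrix groups, their Lie algebras and linear differential equations -/

section MatrixGroups

variable {N : ℕ} {G : Subgroup (Matrix.unitaryGroup (Fin N) ℂ)}

@[simp] lemma mat_one : mat (1 : G) = 1 := rfl

lemma mat_mul (g h : G) : mat (g * h) = mat g * mat h := rfl

lemma mat_inv (g : G) : mat g⁻¹ = (mat g).conjTranspose := rfl

lemma mat_injective : Function.Injective (mat : G → Matrix (Fin N) (Fin N) ℂ) :=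
  Subtype.val_injective.comp Subtype.val_injective

lemma mat_conjTranspose_mul (g : G) : (mat g).conjTranspose * mat g = 1 := by
  rw [← mat_inv, ← mat_mul, inv_mul_cancel, mat_one]

lemma mat_mul_conjTranspose (g : G) : mat g * (mat g).conjTranspose = 1 := by
  rw [← mat_inv, ← mat_mul, mul_inv_cancel, mat_one]

/-- Derivatives and continuity of matrix curves are expressed entry by entry, as in the definition
of a horizontal lift, so that no norm on matrices has to be fixed. -/
lemma hasDerivWithinAt_matrix_mul {X Y : ℝ → Matrix (Fin N) (Fin N) ℂ}
    {X' Y' : Matrix (Fin N) (Fin N) ℂ} {s : Set ℝ} {t : ℝ}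
    (hX : ∀ k l, HasDerivWithinAt (fun τ => X τ k l) (X' k l) s t)
    (hY : ∀ k l, HasDerivWithinAt (fun τ => Y τ k l) (Y' k l) s t) (k l : Fin N) :
    HasDerivWithinAt (fun τ => (X τ * Y τ) k l) ((X' * Y t + X t * Y') k l) s t := by
  simp only [Matrix.mul_apply, Matrix.add_apply, ← Finset.sum_add_distrib]
  exact HasDerivWithinAt.fun_sum fun m _ => (hX k m).mul (hY m l)

lemma hasDerivAt_matrix_mul {X Y : ℝ → Matrix (Fin N) (Fin N) ℂ}
    {X' Y' : Matrix (Fin N) (Fin N) ℂ} {t : ℝ}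
    (hX : ∀ k l, HasDerivAt (fun τ => X τ k l) (X' k l) t)
    (hY : ∀ k l, HasDerivAt (fun τ => Y τ k l) (Y' k l) t) (k l : Fin N) :
    HasDerivAt (fun τ => (X τ * Y τ) k l) ((X' * Y t + X t * Y') k l) t := by
  simp only [← hasDerivWithinAt_univ] at hX hY ⊢
  exact hasDerivWithinAt_matrix_mul hX hY k l

lemma hasDerivWithinAt_conjTranspose {X : ℝ → Matrix (Fin N) (Fin N) ℂ}
    {X' : Matrix (Fin N) (Fin N) ℂ} {s : Set ℝ} {t : ℝ}
    (hX : ∀ k l, HasDerivWithinAt (fun τ => X τ k l) (X' k l) s t) (k l : Fin N) :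
    HasDerivWithinAt (fun τ => (X τ).conjTranspose k l) (X'.conjTranspose k l) s t :=
  (hX l k).star

lemma hasDerivAt_conjTranspose {X : ℝ → Matrix (Fin N) (Fin N) ℂ}
    {X' : Matrix (Fin N) (Fin N) ℂ} {t : ℝ}
    (hX : ∀ k l, HasDerivAt (fun τ => X τ k l) (X' k l) t) (k l : Fin N) :
    HasDerivAt (fun τ => (X τ).conjTranspose k l) (X'.conjTranspose k l) t :=
  (hX l k).star

lemma continuousOn_matrix_mul {α : Type*} [TopologicalSpace α]
    {X Y : α → Matrix (Fin N) (Fin N) ℂ} {s : Set α}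
    (hX : ∀ k l, ContinuousOn (fun τ => X τ k l) s)
    (hY : ∀ k l, ContinuousOn (fun τ => Y τ k l) s) (k l : Fin N) :
    ContinuousOn (fun τ => (X τ * Y τ) k l) s := by
  simp only [Matrix.mul_apply]
  exact continuousOn_finsetSum _ fun m _ => (hX k m).mul (hY m l)

lemma hasDerivAt_exp_entry (X : Matrix (Fin N) (Fin N) ℂ) (k l : Fin N) :
    HasDerivAt (fun t : ℝ => NormedSpace.exp (t • X) k l) (X k l) 0 := by
  let := Matrix.linftyOpNormedRing (n := Fin N) (α := ℂ)
  let := Matrix.linftyOpNormedAlgebra (R := ℝ) (n := Fin N) (α := ℂ)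
  have h := hasDerivAt_exp_smul_const (𝕂 := ℝ) X 0
  rw [zero_smul, NormedSpace.exp_zero, one_mul] at h
  let L : Matrix (Fin N) (Fin N) ℂ →ₗ[ℝ] ℂ := Matrix.entryLinearMap ℝ ℂ k l
  exact L.toContinuousLinearMap.hasFDerivAt.comp_hasDerivAt 0 h

/-- Differentiate `exp(tX)* exp(tX) = 1` at `t = 0`. -/
lemma conjTranspose_of_mem_lieAlg {X : Matrix (Fin N) (Fin N) ℂ} (hX : X ∈ lieAlg G) :
    X.conjTranspose = -X := by
  have h1 := hasDerivAt_exp_entry X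
  have h2 := fun k l => hasDerivAt_matrix_mul (hasDerivAt_conjTranspose h1) h1 k l
  ext k l
  have h3 : (fun τ : ℝ => ((NormedSpace.exp (τ • X)).conjTranspose * NormedSpace.exp (τ • X)) k l) =
      fun _ => (1 : Matrix (Fin N) (Fin N) ℂ) k l := by
    ext τ
    obtain ⟨g, hg⟩ := hX τ
    rw [← hg, mat_conjTranspose_mul]
  have h4 := h2 k l
  rw [h3] at h4
  have h5 := h4.unique (hasDerivAt_const _ _)
  rw [zero_smul, NormedSpace.exp_zero, Matrix.conjTranspose_one, mul_one, one_mul] at h5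
  rw [Matrix.neg_apply]
  exact eq_neg_of_add_eq_zero_left h5

lemma mem_SU_iff {U : Matrix.unitaryGroup (Fin N) ℂ} :
    U ∈ SU N ↔ (U : Matrix (Fin N) (Fin N) ℂ).det = 1 := Iff.rfl

/-- Differentiate `det exp(tX) = 1` at `t = 0`. -/
lemma trace_of_mem_lieAlg_SU {X : Matrix (Fin 2) (Fin 2) ℂ} (hX : X ∈ lieAlg (SU 2)) :
    X 0 0 + X 1 1 = 0 := by
  have h1 := hasDerivAt_exp_entry X
  have h2 := ((h1 0 0).mul (h1 1 1)).sub ((h1 0 1).mul (h1 1 0))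
  have h3 : ((fun t : ℝ => NormedSpace.exp (t • X) 0 0) * fun t : ℝ => NormedSpace.exp (t • X) 1 1) -
      ((fun t : ℝ => NormedSpace.exp (t • X) 0 1) * fun t : ℝ => NormedSpace.exp (t • X) 1 0) =
      fun _ => (1 : ℂ) := by
    ext τ
    obtain ⟨g, hg⟩ := hX τ
    have := mem_SU_iff.1 g.2
    simp only [Pi.sub_apply, Pi.mul_apply, ← Matrix.det_fin_two]
    rw [← hg]
    exact this
  rw [h3] at h2
  simpa using h2.unique (hasDerivAt_const _ _)

lemma hasDerivWithinAt_const_of_zero {f : ℝ → ℂ} {s t : ℝ}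
    (h : ∀ τ ∈ Icc s t, HasDerivWithinAt f 0 (Icc s t) τ) :
    ∀ τ ∈ Icc s t, f τ = f s := by
  refine constant_of_has_deriv_right_zero (fun τ hτ => (h τ hτ).continuousWithinAt) fun τ hτ => ?_
  exact ((h τ (Ico_subset_Icc_self hτ)).mono_of_mem_nhdsWithin
    (Icc_mem_nhdsGE_of_mem hτ))

/-- A solution of `h' = - a h` with `a` in the Lie algebra and `h s = 1` stays in the group. -/
lemma exists_mat_eq_of_solution (hG : IsU1OrSU2 G) {a h : ℝ → Matrix (Fin N) (Fin N) ℂ} {s t : ℝ}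
    (ha : ∀ τ ∈ Icc s t, a τ ∈ lieAlg G) (hs : h s = 1)
    (hd : ∀ τ ∈ Icc s t, ∀ k l,
      HasDerivWithinAt (fun σ => h σ k l) ((-(a τ * h τ)) k l) (Icc s t) τ) :
    ∀ τ ∈ Icc s t, ∃ g : G, mat g = h τ := by
  -- `(h* h)' = -h* (a* + a) h = 0`, since `a` is skew-Hermitian.
  have hU : ∀ τ ∈ Icc s t, (h τ).conjTranspose * h τ = 1 := by
    intro τ hτ
    ext k l
    have := hasDerivWithinAt_const_of_zero (f := fun σ => ((h σ).conjTranspose * h σ) k l)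
      (s := s) (t := t) (fun σ hσ => by
        have h1 := hasDerivWithinAt_matrix_mul (hasDerivWithinAt_conjTranspose (hd σ hσ))
          (hd σ hσ) k l
        rw [Matrix.conjTranspose_neg, Matrix.conjTranspose_mul,
          conjTranspose_of_mem_lieAlg (ha σ hσ)] at h1
        convert h1 using 1
        simp [Matrix.mul_assoc]) τ hτ
    simpa [hs] using this
  have hmem : ∀ τ ∈ Icc s t, h τ ∈ Matrix.unitaryGroup (Fin N) ℂ := fun τ hτ =>
    Matrix.mem_unitaryGroup_iff'.2 (hU τ hτ)
  cases hG with
  | u1 => exact fun τ hτ => ⟨⟨⟨h τ, hmem τ hτ⟩, trivial⟩, rfl⟩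
  | su2 =>
    intro τ hτ
    -- Liouville's formula: `(det h)' = -(tr a) det h = 0`.
    have hdet : (h τ).det = 1 := by
      have := hasDerivWithinAt_const_of_zero (f := fun σ => h σ 0 0 * h σ 1 1 - h σ 0 1 * h σ 1 0)
        (s := s) (t := t) (fun σ hσ => by
          have h1 := (((hd σ hσ) 0 0).mul ((hd σ hσ) 1 1)).sub
            (((hd σ hσ) 0 1).mul ((hd σ hσ) 1 0))
          refine HasDerivWithinAt.congr_deriv h1 ?_
          simp only [Matrix.neg_apply, Matrix.mul_apply, Fin.sum_univ_two]
          linear_combination -(h σ 0 0 * h σ 1 1 - h σ 0 1 * h σ 1 0) *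
            trace_of_mem_lieAlg_SU (ha σ hσ)) τ hτ
      rw [Matrix.det_fin_two, this, hs]
      simp
    exact ⟨⟨⟨h τ, hmem τ hτ⟩, mem_SU_iff.2 hdet⟩, rfl⟩

/-- Local existence for linear differential equations. -/
lemma exists_linear_solution {𝔸 : Type*} [NormedRing 𝔸] [NormedAlgebra ℝ 𝔸] [CompleteSpace 𝔸]
    {a : ℝ → 𝔸} {s t K : ℝ} (hst : s ≤ t) (ha : ContinuousOn a (Icc s t))
    (hK : ∀ τ ∈ Icc s t, ‖a τ‖ ≤ K) (hKst : K * (‖(1 : 𝔸)‖ + 1) * (t - s) ≤ 1) :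
    ∃ h : ℝ → 𝔸, h s = 1 ∧ ∀ τ ∈ Icc s t, HasDerivWithinAt h (a τ * h τ) (Icc s t) τ := by
  have hK0 : 0 ≤ K := (norm_nonneg _).trans (hK s ⟨le_rfl, hst⟩)
  lift K to NNReal using hK0
  -- Picard–Lindelöf on the unit ball around `1`. There `‖x‖ ≤ ‖1‖ + 1`, so the field is bounded by
  -- `K (‖1‖ + 1)`, and `hKst` keeps the solution in the ball.
  have hpl : IsPicardLindelof (fun τ x => a τ * x) (tmin := s) (tmax := t) ⟨s, le_rfl, hst⟩ (1 : 𝔸)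
      1 0 (K * (‖(1 : 𝔸)‖₊ + 1)) K := by
    constructor
    · intro τ hτ
      refine LipschitzOnWith.of_dist_le_mul fun x _ y _ => ?_
      rw [dist_eq_norm, dist_eq_norm, ← mul_sub]
      exact (norm_mul_le _ _).trans (by gcongr; exact hK τ hτ)
    · exact fun x _ => ha.mul continuousOn_const
    · intro τ hτ x hx
      have hx' : ‖x‖ ≤ ‖(1 : 𝔸)‖ + 1 := by
        rw [mem_closedBall_iff_norm] at hx
        calc ‖x‖ = ‖1 + (x - 1)‖ := by simp
          _ ≤ _ := (norm_add_le _ _).trans (by gcongr; exact hx)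
      push_cast
      exact (norm_mul_le _ _).trans (mul_le_mul (hK τ hτ) hx' (norm_nonneg _) K.2)
    · simpa [sub_nonneg.2 hst] using hKst
  simpa using hpl.exists_eq_forall_mem_Icc_hasDerivWithinAt₀

end MatrixGroups

/-! ### Horizontal lifts: translation, gluing and reparametrization -/

section Lifts

variable {N : ℕ} {G : Subgroup (Matrix.unitaryGroup (Fin N) ℂ)}
  {E : Type*} [NormedAddCommGroup E] [NormedSpace ℝ E]
  {M : Type*} [TopologicalSpace M] [ChartedSpace E M] [IsManifold 𝓘(ℝ, E) ω M] {P : Type*}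
  {B : PrincipalBundle G E M P}

/-- The velocity of a curve. -/
def velocity (c : ℝ → M) (t : ℝ) : TangentSpace 𝓘(ℝ, E) (c t) :=
  mfderiv 𝓘(ℝ, ℝ) 𝓘(ℝ, E) c t (1 : ℝ)

/-- `u` satisfies at the time `t` the equation of parallel transport along `c` in the `i`-th
trivialization. -/
def LiftEqAt (A : Connection B) (c : ℝ → M) (u : ℝ → P) (i : B.ι) (t : ℝ) : Prop :=
  ∀ k l, HasDerivAt (fun s => mat (B.coord i (u s)) k l)
    (-(A.form i (c t) (velocity c t) * mat (B.coord i (u t))) k l) t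

/-- `u` is a horizontal lift of the curve `c` on the interval `[a, b]`. -/
def IsLiftOn (A : Connection B) (c : ℝ → M) (a b : ℝ) (u : ℝ → P) : Prop :=
  (∀ t ∈ Icc a b, B.proj (u t) = c t) ∧
  (∀ i k l, ContinuousOn (fun t => mat (B.coord i (u t)) k l) (Icc a b ∩ c ⁻¹' B.dom i)) ∧
  ∃ S : Set ℝ, S.Finite ∧ ∀ t ∈ Ioo a b \ S, ∀ i, c t ∈ B.dom i → LiftEqAt A c u i t

/-- A continuous curve on `[a, b]` that is differentiable off a finite set. -/
structure IsPiecewiseDiff (E : Type*) [NormedAddCommGroup E] [NormedSpace ℝ E]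
    {M : Type*} [TopologicalSpace M] [ChartedSpace E M] (c : ℝ → M) (a b : ℝ) : Prop where
  continuousOn : ContinuousOn c (Icc a b)
  mdifferentiableAt : ∃ S : Set ℝ, S.Finite ∧
    ∀ t ∈ Ioo a b \ S, MDifferentiableAt 𝓘(ℝ, ℝ) 𝓘(ℝ, E) c t

lemma eventually_mem_dom {c : ℝ → M} {a b t : ℝ} (hc : ContinuousOn c (Icc a b))
    (ht : t ∈ Ioo a b) {i : B.ι} (hi : c t ∈ B.dom i) :
    ∀ᶠ s in nhds t, s ∈ Icc a b ∧ c s ∈ B.dom i := by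
  have h1 : Icc a b ∈ nhds t := Icc_mem_nhds ht.1 ht.2
  have h2 := (hc.continuousAt h1).preimage_mem_nhds ((B.isOpen_dom i).mem_nhds hi)
  filter_upwards [h1, h2] with s hs hs' using ⟨hs, hs'⟩

/-- In `h' = -A h` the connection multiplies on the left, so right multiplication by a constant `g`
preserves the equation. -/
lemma IsLiftOn.act {A : Connection B} {c : ℝ → M} {a b : ℝ} {u : ℝ → P}
    (hc : ContinuousOn c (Icc a b)) (hu : IsLiftOn A c a b u) (g : G) :
    IsLiftOn A c a b fun t => B.act (u t) g := by
  obtain ⟨h1, h2, S, hS, h3⟩ := hu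
  refine ⟨fun t ht => by rw [B.proj_act, h1 t ht], fun i k l => ?_, S, hS, fun t ht i hi k l => ?_⟩
  · refine (continuousOn_matrix_mul (X := fun t => mat (B.coord i (u t))) (Y := fun _ => mat g)
      (h2 i) (fun _ _ => continuousOn_const) k l).congr fun t ht => ?_
    simp only [B.coord_act i _ g (by rw [h1 t ht.1]; exact ht.2 : B.proj (u t) ∈ B.dom i), mat_mul]
  · have hev : ∀ᶠ s in nhds t, mat (B.coord i (B.act (u s) g)) = mat (B.coord i (u s)) * mat g := by
      filter_upwards [eventually_mem_dom hc ht.1 hi] with s hs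
      rw [B.coord_act i _ g (by rw [h1 s hs.1]; exact hs.2), mat_mul]
    have h4 := hasDerivAt_matrix_mul (Y := fun _ => mat g) (Y' := 0)
      (X' := -(A.form i (c t) (velocity c t) * mat (B.coord i (u t)))) (h3 t ht i hi)
      (fun k l => by simpa using hasDerivAt_const t (mat g k l)) k l
    rw [hev.self_of_nhds]
    refine (h4.congr_of_eventuallyEq (hev.mono fun s hs => by rw [hs])).congr_deriv ?_
    simp [Matrix.mul_assoc]

lemma IsLiftOn.congr {A : Connection B} {c c' : ℝ → M} {a b : ℝ} {u u' : ℝ → P}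
    (hu : IsLiftOn A c a b u) (hc : EqOn c c' (Icc a b)) (huu : EqOn u u' (Icc a b)) :
    IsLiftOn A c' a b u' := by
  obtain ⟨h1, h2, S, hS, h3⟩ := hu
  refine ⟨fun t ht => by rw [← huu ht, ← hc ht, h1 t ht], fun i k l => ?_, S, hS,
    fun t ht i hi k l => ?_⟩
  · have hset : Icc a b ∩ c' ⁻¹' B.dom i = Icc a b ∩ c ⁻¹' B.dom i := by
      ext t
      exact and_congr_right fun ht => by rw [mem_preimage, mem_preimage, hc ht]
    rw [hset]
    exact (h2 i k l).congr fun t ht => by simp only [huu ht.1]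
  · have hn : Icc a b ∈ nhds t := Icc_mem_nhds ht.1.1 ht.1.2
    have hct : c t = c' t := hc (mem_of_mem_nhds hn)
    have hcc : c =ᶠ[nhds t] c' := Filter.eventually_of_mem hn hc
    have hv : A.form i (c t) (velocity c t) = A.form i (c' t) (velocity c' t) := by
      unfold velocity
      rw [hcc.mfderiv_eq]
      congr!
    have h4 := h3 t ht i (by rwa [hct]) k l
    rw [hv, huu (mem_of_mem_nhds hn)] at h4
    exact h4.congr_of_eventuallyEq (Filter.eventually_of_mem hn fun s hs => by
      simp only [huu hs])

/-- Lifts on adjacent intervals fit together. -/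
lemma IsLiftOn.union {A : Connection B} {c : ℝ → M} {a m b : ℝ} {u : ℝ → P} (ham : a ≤ m)
    (hmb : m ≤ b) (h : IsLiftOn A c a m u) (h' : IsLiftOn A c m b u) : IsLiftOn A c a b u := by
  obtain ⟨h1, h2, S, hS, h3⟩ := h
  obtain ⟨h1', h2', S', hS', h3'⟩ := h'
  have hU : Icc a b = Icc a m ∪ Icc m b := (Icc_union_Icc_eq_Icc ham hmb).symm
  -- The curve may have a corner at the junction, so `m` joins the exceptional set.
  refine ⟨fun t ht => ?_, fun i k l => ?_, insert m (S ∪ S'), (hS.union hS').insert m,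
    fun t ht i hi => ?_⟩
  · rw [hU] at ht
    exact ht.elim (h1 t) (h1' t)
  · rw [hU, union_inter_distrib_right]
    have aux : ∀ {p q : ℝ}, ContinuousOn (fun t => mat (B.coord i (u t)) k l)
        (Icc p q ∩ c ⁻¹' B.dom i) → ∀ t, c t ∈ B.dom i → ContinuousWithinAt
          (fun t => mat (B.coord i (u t)) k l) (Icc p q ∩ c ⁻¹' B.dom i) t := by
      intro p q hcont t hct
      by_cases ht : t ∈ Icc p q
      · exact hcont t ⟨ht, hct⟩
      · refine continuousWithinAt_of_notMem_closure fun hcl => ht ?_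
        exact isClosed_Icc.closure_subset_iff.2 inter_subset_left hcl
    intro t ht
    have hct : c t ∈ B.dom i := ht.elim (fun h => h.2) fun h => h.2
    exact (aux (h2 i k l) t hct).union (aux (h2' i k l) t hct)
  · simp only [mem_sdiff, mem_insert_iff, mem_union, not_or] at ht
    obtain ⟨⟨hat, htb⟩, htm, htS, htS'⟩ := ht
    rcases lt_or_gt_of_ne htm with hlt | hgt
    · exact h3 t ⟨⟨hat, hlt⟩, htS⟩ i hi
    · exact h3' t ⟨⟨hgt, htb⟩, htS'⟩ i hi

lemma IsLiftOn.concat {A : Connection B} {c : ℝ → M} {a m b : ℝ} {u v : ℝ → P} (ham : a ≤ m)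
    (hmb : m ≤ b) (h : IsLiftOn A c a m u) (h' : IsLiftOn A c m b v) (huv : u m = v m) :
    IsLiftOn A c a b fun t => if t ≤ m then u t else v t := by
  refine IsLiftOn.union ham hmb (h.congr (fun _ _ => rfl) fun t ht => (if_pos ht.2).symm)
    (h'.congr (fun _ _ => rfl) fun t ht => ?_)
  rcases eq_or_lt_of_le ht.1 with rfl | hlt
  · simp [huv]
  · exact (if_neg hlt.not_ge).symm

/-- The lift of an affine reparametrization of a curve. -/
lemma IsLiftOn.comp_affine {A : Connection B} {c : ℝ → M} {a b a' b' : ℝ} {u : ℝ → P}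
    (hc : IsPiecewiseDiff E c a b) (hu : IsLiftOn A c a b u) (ε d : ℝ) (hε : ε ≠ 0)
    (hI : MapsTo (fun t => ε * t + d) (Icc a' b') (Icc a b))
    (hI' : MapsTo (fun t => ε * t + d) (Ioo a' b') (Ioo a b)) :
    IsLiftOn A (fun t => c (ε * t + d)) a' b' fun t => u (ε * t + d) := by
  obtain ⟨h1, h2, S, hS, h3⟩ := hu
  obtain ⟨S', hS', hdiff⟩ := hc.mdifferentiableAt
  have hinj : Function.Injective fun t : ℝ => ε * t + d := fun x y hxy => by
    simpa [hε] using hxy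
  refine ⟨fun t ht => h1 _ (hI ht), fun i k l => ?_, (fun t : ℝ => ε * t + d) ⁻¹' (S ∪ S'),
    (hS.union hS').preimage hinj.injOn, fun t ht i hi k l => ?_⟩
  · exact (h2 i k l).comp (by fun_prop) fun t ht => ⟨hI ht.1, ht.2⟩
  · have htI := hI' ht.1
    have htS : ε * t + d ∉ S ∧ ε * t + d ∉ S' := by
      simpa [not_or] using ht.2
    have hφ : HasDerivAt (fun t => ε * t + d) ε t := by
      simpa using ((hasDerivAt_id t).const_mul ε).add_const d
    have hv : velocity (E := E) (fun t => c (ε * t + d)) t = ε • velocity c (ε * t + d) := by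
      have hm := (hdiff _ ⟨htI, htS.2⟩).hasMFDerivAt.comp t
        (hφ.hasFDerivAt.hasMFDerivAt (f := fun t : ℝ => ε * t + d))
      unfold velocity
      rw [show (fun t => c (ε * t + d)) = c ∘ fun t => ε * t + d from rfl, hm.mfderiv]
      have h5 : (ContinuousLinearMap.toSpanSingleton ℝ ε) (1 : ℝ) = ε • (1 : ℝ) := by simp
      exact (congrArg (mfderiv 𝓘(ℝ, ℝ) 𝓘(ℝ, E) c (ε * t + d)) h5).trans
        (map_smul (mfderiv 𝓘(ℝ, ℝ) 𝓘(ℝ, E) c (ε * t + d)) ε (1 : ℝ))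
    have h4 := (h3 _ ⟨htI, htS.1⟩ i hi k l).scomp t hφ
    refine h4.congr_deriv ?_
    rw [hv, map_smul]
    simp

end Lifts

/-! ### Existence and uniqueness of parallel transport -/

section Transport

variable {N : ℕ} {G : Subgroup (Matrix.unitaryGroup (Fin N) ℂ)}
  {E : Type*} [NormedAddCommGroup E] [NormedSpace ℝ E]
  {M : Type*} [TopologicalSpace M] [ChartedSpace E M] [IsManifold 𝓘(ℝ, E) ω M] {P : Type*}
  {B : PrincipalBundle G E M P}

/-- The chain rule along a curve. -/
lemma hasDerivAt_comp_velocity {f : M → ℂ} {c : ℝ → M} {t : ℝ}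
    (hf : MDifferentiableAt 𝓘(ℝ, E) 𝓘(ℝ, ℂ) f (c t))
    (hc : MDifferentiableAt 𝓘(ℝ, ℝ) 𝓘(ℝ, E) c t) :
    HasDerivAt (fun s => f (c s)) (mfderiv 𝓘(ℝ, E) 𝓘(ℝ, ℂ) f (c t) (velocity c t)) t := by
  have h : HasFDerivAt (fun s => f (c s)) (show ℝ →L[ℝ] ℂ from
      (mfderiv 𝓘(ℝ, E) 𝓘(ℝ, ℂ) f (c t)).comp (mfderiv 𝓘(ℝ, ℝ) 𝓘(ℝ, E) c t)) t :=
    (hf.hasMFDerivAt.comp t hc.hasMFDerivAt).hasFDerivAt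
  exact h.hasDerivAt

lemma mdifferentiableAt_trans (B : PrincipalBundle G E M P) {i j : B.ι} {x : M} (hi : x ∈ B.dom i)
    (hj : x ∈ B.dom j) (k l : Fin N) :
    MDifferentiableAt 𝓘(ℝ, E) 𝓘(ℝ, ℂ) (fun y => mat (B.trans i j y) k l) x :=
  ((B.smooth_trans i j k l).contMDiffAt
    (((B.isOpen_dom i).inter (B.isOpen_dom j)).mem_nhds ⟨hi, hj⟩)).mdifferentiableAt (by simp)

/-- The equation of parallel transport does not depend on the trivialization. -/
lemma LiftEqAt.change {A : Connection B} {c : ℝ → M} {u : ℝ → P} {i j : B.ι} {t : ℝ}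
    (h : LiftEqAt A c u i t) (hi : c t ∈ B.dom i) (hj : c t ∈ B.dom j)
    (hc : MDifferentiableAt 𝓘(ℝ, ℝ) 𝓘(ℝ, E) c t) (hu : ∀ᶠ s in nhds t, B.proj (u s) = c s) :
    LiftEqAt A c u j t := by
  intro k l
  have hev : ∀ᶠ s in nhds t, mat (B.coord j (u s)) =
      mat (B.trans j i (c s)) * mat (B.coord i (u s)) := by
    filter_upwards [hu, hc.continuousAt.preimage_mem_nhds ((B.isOpen_dom i).mem_nhds hi),
      hc.continuousAt.preimage_mem_nhds ((B.isOpen_dom j).mem_nhds hj)] with s h1 h2 h3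
    rw [← mat_mul, B.coord_eq j i (u s) (by rwa [h1]) (by rwa [h1]), h1]
  have hT := fun k l => hasDerivAt_comp_velocity (mdifferentiableAt_trans B hj hi k l) hc
  set T := mat (B.trans j i (c t))
  set dT : Matrix (Fin N) (Fin N) ℂ := Matrix.of fun k l =>
    (mfderiv 𝓘(ℝ, E) 𝓘(ℝ, ℂ) (fun y => mat (B.trans j i y) k l) (c t) (velocity c t) : ℂ) with hdT
  have h4 := hasDerivAt_matrix_mul (X := fun s => mat (B.trans j i (c s))) (X' := dT)
    (Y := fun s => mat (B.coord i (u s)))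
    (Y' := -(A.form i (c t) (velocity c t) * mat (B.coord i (u t)))) hT h k l
  refine (h4.congr_of_eventuallyEq (hev.mono fun s hs => by simp only [hs])).congr_deriv ?_
  have hform := A.form_trans j i (c t) hj hi (velocity c t)
  rw [hev.self_of_nhds, ← Matrix.neg_apply]
  refine congrFun (congrFun ?_ k) l
  have hTT : T * mat (B.trans j i (c t))⁻¹ = 1 := by
    rw [mat_inv]; exact mat_mul_conjTranspose _
  -- The transformation law of the forms, multiplied by `T = gⱼᵢ`. In the derivative `dT h - T Aᵢ h`
  -- of `T h` the terms with `dT` then cancel and `-Aⱼ T h` remains.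
  have h5 : T * A.form i (c t) (velocity c t) = A.form j (c t) (velocity c t) * T + dT := by
    rw [hform, mul_add, ← mul_assoc, ← mul_assoc, hTT, one_mul, ← mul_assoc, hTT, one_mul]
  rw [Matrix.mul_neg, ← Matrix.mul_assoc, h5]
  rw [Matrix.add_mul, Matrix.mul_assoc, neg_add_rev, add_neg_cancel_left]

/-- A horizontal lift is determined by its initial point. -/
lemma IsLiftOn.eq_right_of_eq_left {A : Connection B} {c : ℝ → M} {a b : ℝ} {u v : ℝ → P}
    (hab : a ≤ b)
    (hc : ContinuousOn c (Icc a b)) (hu : IsLiftOn A c a b u) (hv : IsLiftOn A c a b v)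
    (h0 : u a = v a) : u b = v b := by
  obtain ⟨h1, h2, S, hS, h3⟩ := hu
  obtain ⟨h1', h2', S', hS', h3'⟩ := hv
  have hex : ∀ t, ∃ g : G, t ∈ Icc a b → B.act (u t) g = v t := fun t => by
    by_cases ht : t ∈ Icc a b
    · exact (B.existsUnique_act (u t) (v t) (by rw [h1 t ht, h1' t ht])).exists.imp fun _ h _ => h
    · exact ⟨1, fun h => absurd h ht⟩
  choose g hg using hex
  -- The comparison element `g` with `v = u g` equals `h_u⁻¹ h_v` in every trivialization at once,
  -- so it may be differentiated locally.
  have hgi : ∀ t ∈ Icc a b, ∀ i, c t ∈ B.dom i → mat (g t) =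
      (mat (B.coord i (u t))).conjTranspose * mat (B.coord i (v t)) := by
    intro t ht i hi
    rw [← hg t ht, B.coord_act i _ _ (by rwa [h1 t ht]), mat_mul, ← Matrix.mul_assoc,
      mat_conjTranspose_mul, one_mul]
  -- Since `Aᵢ` is skew-Hermitian, `(h_u* h_v)' = 0` off a finite set. As `g` is continuous on the
  -- whole interval, the fundamental theorem of calculus with countably many exceptions makes it
  -- constant.
  have hconst : ∀ k l, mat (g b) k l = mat (g a) k l := by
    intro k l
    have hintegral := MeasureTheory.integral_eq_of_hasDerivAt_off_countable (a := a) (b := b)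
      (fun t => mat (g t) k l) (fun _ => 0) (hS.union hS').countable ?_ ?_ (by simp)
    · simp only [intervalIntegral.integral_zero] at hintegral
      exact (sub_eq_zero.1 hintegral.symm)
    · rw [uIcc_of_le hab]
      intro t ht
      obtain ⟨i, hi⟩ := B.cover (c t)
      have hcont := continuousOn_matrix_mul (X := fun t => (mat (B.coord i (u t))).conjTranspose)
        (Y := fun t => mat (B.coord i (v t))) (fun k l => (h2 i l k).star) (h2' i) k l
      have hnb : Icc a b ∩ c ⁻¹' B.dom i ∈ nhdsWithin t (Icc a b) :=
        Filter.inter_mem self_mem_nhdsWithin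
          ((hc t ht).preimage_mem_nhdsWithin ((B.isOpen_dom i).mem_nhds hi))
      refine (ContinuousWithinAt.mono_of_mem_nhdsWithin (hcont t ⟨ht, hi⟩) hnb).congr_of_eventuallyEq
        ?_ (by simp only [hgi t ht i hi])
      filter_upwards [hnb] with s hs
      simp only [hgi s hs.1 i hs.2]
    · rw [min_eq_left hab, max_eq_right hab]
      rintro t ⟨ht, htS⟩
      obtain ⟨i, hi⟩ := B.cover (c t)
      have htS' : t ∉ S ∧ t ∉ S' := by simpa [not_or] using htS
      have e1 := h3 t ⟨ht, htS'.1⟩ i hi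
      have e2 := h3' t ⟨ht, htS'.2⟩ i hi
      have e3 := hasDerivAt_matrix_mul
        (X := fun t => (mat (B.coord i (u t))).conjTranspose)
        (X' := (-(A.form i (c t) (velocity c t) * mat (B.coord i (u t)))).conjTranspose)
        (Y := fun t => mat (B.coord i (v t)))
        (Y' := -(A.form i (c t) (velocity c t) * mat (B.coord i (v t))))
        (hasDerivAt_conjTranspose (X := fun t => mat (B.coord i (u t)))
          (X' := -(A.form i (c t) (velocity c t) * mat (B.coord i (u t)))) e1) e2 k l
      refine (e3.congr_of_eventuallyEq ?_).congr_deriv ?_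
      · filter_upwards [eventually_mem_dom hc ht hi] with s hs
        simp only [hgi s hs.1 i hs.2]
      · rw [Matrix.conjTranspose_neg, Matrix.conjTranspose_mul,
          conjTranspose_of_mem_lieAlg (A.form_mem i _ hi _)]
        simp [Matrix.mul_assoc]
  have hga : g a = 1 := by
    have ha := hg a ⟨le_rfl, hab⟩
    exact (B.existsUnique_act (u a) (v a) (by rw [h0])).unique ha (by rw [B.act_one, h0])
  have hgb : g b = 1 := by
    rw [← hga]
    exact mat_injective (Matrix.ext hconst)
  have := hg b ⟨hab, le_rfl⟩
  rwa [hgb, B.act_one] at this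

/-- A point with prescribed coordinate. -/
lemma exists_coord_eq (B : PrincipalBundle G E M P) {x : M} {i : B.ι} (hi : x ∈ B.dom i) (g : G) :
    ∃ p, B.proj p = x ∧ B.coord i p = g := by
  obtain ⟨q, rfl⟩ := B.proj_surjective x
  refine ⟨B.act q ((B.coord i q)⁻¹ * g), B.proj_act _ _, ?_⟩
  rw [B.coord_act i q _ hi, mul_inv_cancel_left]

lemma eq_of_coord_eq {p q : P} {i : B.ι} (hp : B.proj p ∈ B.dom i) (h : B.proj p = B.proj q)
    (hc : B.coord i p = B.coord i q) : p = q := by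
  obtain ⟨g, rfl, -⟩ := B.existsUnique_act p q h
  rw [B.coord_act i p g hp, left_eq_mul] at hc
  rw [hc, B.act_one]

/-- The components of the connection along a `C¹` curve are continuous. -/
lemma continuousOn_form_velocity (A : Connection B) {c : ℝ → M} {s t : ℝ} (hst : s < t)
    (hc : ContMDiffOn 𝓘(ℝ, ℝ) 𝓘(ℝ, E) 1 c (Icc s t)) (i : B.ι) (k l : Fin N) :
    ContinuousOn (fun τ => A.form i (c τ)
      (mfderivWithin 𝓘(ℝ, ℝ) 𝓘(ℝ, E) c (Icc s t) τ (1 : ℝ)) k l) (Icc s t ∩ c ⁻¹' B.dom i) := by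
  have : IsManifold 𝓘(ℝ, E) 1 M := IsManifold.of_le (n := ω) le_top
  have h1 := hc.continuousOn_tangentMapWithin le_rfl (uniqueDiffOn_Icc hst).uniqueMDiffOn
  have h2 : Continuous fun τ : ℝ => (⟨τ, (1 : ℝ)⟩ : TangentBundle 𝓘(ℝ, ℝ) ℝ) :=
    (tangentBundleModelSpaceHomeomorph 𝓘(ℝ, ℝ)).symm.continuous.comp
      (by fun_prop : Continuous fun τ : ℝ => ((τ, 1) : ModelProd ℝ ℝ))
  exact ((A.smooth_form i k l).continuousOn.comp (h1.comp h2.continuousOn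
    (fun τ (hτ : τ ∈ Icc s t ∩ c ⁻¹' B.dom i) => hτ.1)) fun τ hτ => hτ.2)

/-- A solution of the transport equation in a trivialization gives a lift. -/
lemma exists_lift_of_solution (hG : IsU1OrSU2 G) (A : Connection B) {c : ℝ → M} {s t a b : ℝ}
    (hc : ContMDiffOn 𝓘(ℝ, ℝ) 𝓘(ℝ, E) 1 c (Icc s t)) (hab : a ≤ b) (hI : Icc a b ⊆ Icc s t)
    {i : B.ι} (hdom : ∀ σ ∈ Icc a b, c σ ∈ B.dom i) {α h : ℝ → Matrix (Fin N) (Fin N) ℂ}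
    (hα : α = fun σ => A.form i (c σ) (mfderivWithin 𝓘(ℝ, ℝ) 𝓘(ℝ, E) c (Icc s t) σ (1 : ℝ)))
    (ha : h a = 1) (hd' : ∀ σ ∈ Icc a b, ∀ k l,
      HasDerivWithinAt (fun σ => h σ k l) ((-(α σ * h σ)) k l) (Icc a b) σ)
    {p : P} (hp : B.proj p = c a) : ∃ u, IsLiftOn A c a b u ∧ u a = p := by
  have hex := exists_mat_eq_of_solution hG
    (fun σ hσ => by rw [hα]; exact A.form_mem i (c σ) (hdom σ hσ) _) ha hd'
  have hex' : ∀ σ, ∃ g : G, σ ∈ Icc a b → mat g = h σ := fun σ => by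
    by_cases hσ : σ ∈ Icc a b
    · exact (hex σ hσ).imp fun _ h _ => h
    · exact ⟨1, fun h => absurd h hσ⟩
  choose g hg using hex'
  have hu : ∀ σ, ∃ q, σ ∈ Icc a b → B.proj q = c σ ∧ B.coord i q = g σ * B.coord i p := fun σ => by
    by_cases hσ : σ ∈ Icc a b
    · exact (exists_coord_eq B (hdom σ hσ) _).imp fun _ h _ => h
    · exact ⟨p, fun h => absurd h hσ⟩
  choose u hu using hu
  have hcoord : ∀ σ ∈ Icc a b, mat (B.coord i (u σ)) = h σ * mat (B.coord i p) := fun σ hσ => by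
    rw [(hu σ hσ).2, mat_mul, hg σ hσ]
  refine ⟨u, ⟨fun σ hσ => (hu σ hσ).1, fun j k l => ?_, ∅, finite_empty, fun σ hσ j hj => ?_⟩, ?_⟩
  · refine (continuousOn_matrix_mul (X := fun σ => mat (B.trans j i (c σ)))
      (Y := fun σ => h σ * mat (B.coord i p)) (fun k l => ?_) (fun k l => ?_) k l).congr
      fun σ hσ => ?_
    · exact (B.smooth_trans j i k l).continuousOn.comp
        (hc.continuousOn.mono (inter_subset_left.trans hI)) fun σ hσ => ⟨hσ.2, hdom σ hσ.1⟩
    · exact continuousOn_matrix_mul (X := h) (Y := fun _ => mat (B.coord i p))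
        (fun k l σ hσ => ((hd' σ hσ.1 k l).continuousWithinAt).mono inter_subset_left)
        (fun _ _ => continuousOn_const) k l
    · have h1 := (hu σ hσ.1).1
      simp only [B.coord_eq j i (u σ) (by rw [h1]; exact hσ.2) (by rw [h1]; exact hdom σ hσ.1),
        mat_mul, hcoord σ hσ.1, h1]
  · have hσI : Icc a b ∈ nhds σ := Icc_mem_nhds hσ.1.1 hσ.1.2
    have hσ' : σ ∈ Icc a b := mem_of_mem_nhds hσI
    have hsub : Icc s t ∈ nhds σ := Filter.mem_of_superset hσI hI
    have hdiff : MDifferentiableAt 𝓘(ℝ, ℝ) 𝓘(ℝ, E) c σ :=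
      (hc.contMDiffAt hsub).mdifferentiableAt (by simp)
    have hvel : A.form i (c σ) (velocity c σ) = α σ := by
      simp only [hα, velocity, mfderivWithin_of_mem_nhds hsub]
    refine LiftEqAt.change (i := i) (fun k l => ?_) (hdom σ hσ') hj hdiff
      (Filter.eventually_of_mem hσI fun ρ hρ => (hu ρ hρ).1)
    have e1 := hasDerivAt_matrix_mul (X := h) (X' := -(α σ * h σ)) (Y := fun _ => mat (B.coord i p))
      (Y' := 0)
      (fun k l => (hd' σ hσ' k l).hasDerivAt hσI)
      (fun k l => by simpa using hasDerivAt_const σ (mat (B.coord i p) k l)) k l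
    refine (e1.congr_of_eventuallyEq (Filter.eventually_of_mem hσI fun ρ hρ => by
      simp only [hcoord ρ hρ])).congr_deriv ?_
    rw [hvel, hcoord σ hσ']
    simp [Matrix.mul_assoc]
  · have haI : a ∈ Icc a b := ⟨le_rfl, hab⟩
    refine eq_of_coord_eq (i := i) (by rw [(hu a haI).1]; exact hdom a haI)
      (by rw [(hu a haI).1, hp]) (mat_injective ?_)
    rw [hcoord a haI, ha, one_mul]

/-- Local existence of horizontal lifts. -/
lemma exists_nhds_lift (hG : IsU1OrSU2 G) (A : Connection B) {c : ℝ → M} {s t : ℝ} (hst : s < t)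
    (hc : ContMDiffOn 𝓘(ℝ, ℝ) 𝓘(ℝ, E) 1 c (Icc s t)) {τ : ℝ} (hτ : τ ∈ Icc s t) :
    ∃ V : Set ℝ, IsOpen V ∧ τ ∈ V ∧ ∀ a b, a ≤ b → Icc a b ⊆ V → Icc a b ⊆ Icc s t →
      ∀ p, B.proj p = c a → ∃ u, IsLiftOn A c a b u ∧ u a = p := by
  let := Matrix.linftyOpNormedRing (n := Fin N) (α := ℂ)
  let := Matrix.linftyOpNormedAlgebra (R := ℝ) (n := Fin N) (α := ℂ)
  obtain ⟨i, hi⟩ := B.cover (c τ)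
  set α : ℝ → Matrix (Fin N) (Fin N) ℂ := fun σ => A.form i (c σ)
    (mfderivWithin 𝓘(ℝ, ℝ) 𝓘(ℝ, E) c (Icc s t) σ (1 : ℝ)) with hα
  have hαc : ContinuousOn α (Icc s t ∩ c ⁻¹' B.dom i) :=
    continuousOn_pi.2 fun k => continuousOn_pi.2 fun l => continuousOn_form_velocity A hst hc i k l
  have hnb : Icc s t ∩ c ⁻¹' B.dom i ∈ nhdsWithin τ (Icc s t) :=
    Filter.inter_mem self_mem_nhdsWithin
      ((hc.continuousOn τ hτ).preimage_mem_nhdsWithin ((B.isOpen_dom i).mem_nhds hi))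
  have hbd : ∀ᶠ σ in nhdsWithin τ (Icc s t), ‖α σ‖ < ‖α τ‖ + 1 :=
    ((hαc τ ⟨hτ, hi⟩).mono_of_mem_nhdsWithin hnb).norm.eventually_lt_const (lt_add_one _)
  obtain ⟨ε, hε, hball⟩ := Metric.mem_nhdsWithin_iff.1 (Filter.inter_mem hnb hbd)
  set K := ‖α τ‖ + 1
  set R := K * (‖(1 : Matrix (Fin N) (Fin N) ℂ)‖ + 1)
  have hR : 0 < R := by positivity
  -- Radius `ε` keeps the curve in one trivialization with `‖α‖ < K`; radius `1 / (2R)` gives `b - a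
  -- ≤ 1 / R`, the length that `exists_linear_solution` admits. Neither depends on `p`, since the
  -- equation is solved from `1` and multiplied by `coord i p` afterwards. This uniformity lets the
  -- local lifts be chained over a finite subdivision.
  refine ⟨Metric.ball τ (min ε (1 / (2 * R))), Metric.isOpen_ball,
    Metric.mem_ball_self (by positivity), fun a b hab hV hI p hp => ?_⟩
  have hdom : ∀ σ ∈ Icc a b, c σ ∈ B.dom i ∧ ‖α σ‖ < K := fun σ hσ => by
    have := hball ⟨Metric.ball_subset_ball (min_le_left _ _) (hV hσ), hI hσ⟩
    exact ⟨this.1.2, this.2⟩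
  have hlen : R * (b - a) ≤ 1 := by
    have h1 := (hV ⟨le_rfl, hab⟩ : a ∈ Metric.ball τ _)
    have h2 := (hV ⟨hab, le_rfl⟩ : b ∈ Metric.ball τ _)
    rw [Metric.mem_ball, Real.dist_eq] at h1 h2
    have h1' := (abs_lt.1 (h1.trans_le (min_le_right _ _))).1
    have h2' := (abs_lt.1 (h2.trans_le (min_le_right _ _))).2
    have h3 : b - a ≤ 1 / R := by
      have : 1 / R = 1 / (2 * R) + 1 / (2 * R) := by field_simp; norm_num
      linarith
    calc R * (b - a) ≤ R * (1 / R) := by gcongr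
      _ = 1 := by field_simp
  obtain ⟨h, ha, hd⟩ := exists_linear_solution (a := fun σ => -α σ) (K := K) hab
    (hαc.mono fun σ hσ => ⟨hI hσ, (hdom σ hσ).1⟩).neg
    (fun σ hσ => by rw [norm_neg]; exact (hdom σ hσ).2.le) hlen
  have hd' : ∀ σ ∈ Icc a b, ∀ k l,
      HasDerivWithinAt (fun σ => h σ k l) ((-(α σ * h σ)) k l) (Icc a b) σ := by
    intro σ hσ k l
    let L : Matrix (Fin N) (Fin N) ℂ →ₗ[ℝ] ℂ := Matrix.entryLinearMap ℝ ℂ k l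
    rw [← neg_mul]
    exact L.toContinuousLinearMap.hasFDerivAt.comp_hasDerivWithinAt σ (hd σ hσ)
  exact exists_lift_of_solution hG A hc hab hI (fun σ hσ => (hdom σ hσ).1) hα ha hd' hp

lemma exists_lift_refl (A : Connection B) {c : ℝ → M} {s : ℝ} {p : P} (hp : B.proj p = c s) :
    ∃ u, IsLiftOn A c s s u ∧ u s = p := by
  refine ⟨fun _ => p, ⟨fun τ hτ => ?_, fun i k l => continuousOn_const, ∅, finite_empty,
    fun τ hτ => ?_⟩, rfl⟩
  · rw [Icc_self, mem_singleton_iff] at hτ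
    rw [hτ, hp]
  · simp at hτ

/-- Existence of horizontal lifts over a `C¹` curve. -/
lemma exists_lift_of_contMDiffOn (hG : IsU1OrSU2 G) (A : Connection B) {c : ℝ → M} {s t : ℝ}
    (hst : s ≤ t) (hc : ContMDiffOn 𝓘(ℝ, ℝ) 𝓘(ℝ, E) 1 c (Icc s t)) (p : P) (hp : B.proj p = c s) :
    ∃ u, IsLiftOn A c s t u ∧ u s = p := by
  rcases hst.eq_or_lt with rfl | hlt
  · exact exists_lift_refl A hp
  have hloc : ∀ x : Icc s t, ∃ V : Set ℝ, IsOpen V ∧ (x : ℝ) ∈ V ∧ ∀ a b, a ≤ b → Icc a b ⊆ V →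
      Icc a b ⊆ Icc s t → ∀ p, B.proj p = c a → ∃ u, IsLiftOn A c a b u ∧ u a = p :=
    fun x => exists_nhds_lift hG A hlt hc x.2
  choose V hVo hxV hV using hloc
  obtain ⟨r, hr0, hmono, ⟨m, hm⟩, hr⟩ := exists_monotone_Icc_subset_open_cover_Icc hst
    (c := fun x : Icc s t => Subtype.val ⁻¹' V x) (fun x => (hVo x).preimage continuous_subtype_val)
    (fun x _ => mem_iUnion.2 ⟨x, hxV x⟩)
  have key : ∀ n : ℕ, ∃ u, IsLiftOn A c s (r n) u ∧ u s = p := by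
    intro n
    induction n with
    | zero =>
      rw [hr0]
      exact exists_lift_refl A hp
    | succ n ih =>
      obtain ⟨u, hu, hus⟩ := ih
      obtain ⟨x, hx⟩ := hr n
      have hle : (r n : ℝ) ≤ r (n + 1) := hmono n.le_succ
      have hsub : Icc (r n : ℝ) (r (n + 1)) ⊆ Icc s t := Icc_subset_Icc (r n).2.1 (r (n + 1)).2.2
      obtain ⟨v, hv, hv0⟩ := hV x (r n) (r (n + 1)) hle
        (fun τ hτ => hx (show (⟨τ, hsub hτ⟩ : Icc s t) ∈ Icc (r n) (r (n + 1)) from hτ)) hsub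
        (u (r n)) (hu.1 _ ⟨(r n).2.1, le_rfl⟩)
      exact ⟨_, hu.concat (r n).2.1 hle hv hv0.symm, by rw [if_pos (r n).2.1, hus]⟩
  have := key m
  rwa [hm m le_rfl] at this

end Transport

/-! ### The group of loops and multiplicativity of holonomy -/

section Loops

variable {N : ℕ} {G : Subgroup (Matrix.unitaryGroup (Fin N) ℂ)}
  {E : Type*} [NormedAddCommGroup E] [NormedSpace ℝ E]
  {M : Type*} [TopologicalSpace M] [ChartedSpace E M] [IsManifold 𝓘(ℝ, E) ω M] {P : Type*}
  {B : PrincipalBundle G E M P}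

lemma exists_mem_Ioo_of_monotone {t : ℕ → ℝ} {n : ℕ} {τ : ℝ} (h0 : t 0 < τ) (hn : τ < t n)
    (hne : ∀ i ≤ n, τ ≠ t i) : ∃ i < n, τ ∈ Ioo (t i) (t (i + 1)) := by
  classical
  have hex : ∃ k, τ < t k := ⟨n, hn⟩
  have hk := Nat.find_spec hex
  have hkn : Nat.find hex ≤ n := Nat.find_min' hex hn
  obtain ⟨i, hi⟩ : ∃ i, Nat.find hex = i + 1 := by
    refine Nat.exists_eq_succ_of_ne_zero fun h => ?_
    rw [h] at hk
    exact lt_asymm h0 hk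
  rw [hi] at hk hkn
  have hi' : ¬ τ < t i := Nat.find_min hex (by omega)
  exact ⟨i, by omega, lt_of_le_of_ne (not_lt.1 hi') (hne i (by omega)).symm, hk⟩

lemma PLoop.isPiecewiseDiff {x₀ : M} (γ : PLoop E x₀) :
    IsPiecewiseDiff E γ.toFun γ.a γ.b := by
  refine ⟨γ.continuousOn, ?_⟩
  obtain ⟨n, t, hmono, h0, hn, hpc⟩ := γ.piecewise_analytic
  refine ⟨t '' Iic n, (finite_Iic n).image t, fun τ hτ => ?_⟩
  obtain ⟨i, hi, hτi⟩ := exists_mem_Ioo_of_monotone (h0 ▸ hτ.1.1) (hn ▸ hτ.1.2)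
    fun i hi h => hτ.2 ⟨i, hi, h.symm⟩
  exact ((hpc i hi).contMDiffAt (Icc_mem_nhds hτi.1 hτi.2)).mdifferentiableAt (by simp)

lemma exists_lift_loop (hG : IsU1OrSU2 G) (A : Connection B) {x₀ : M} (γ : PLoop E x₀) {p : P}
    (hp : B.proj p = x₀) : ∃ u, IsLiftOn A γ.toFun γ.a γ.b u ∧ u γ.a = p := by
  obtain ⟨n, t, hmono, h0, hn, hpc⟩ := γ.piecewise_analytic
  have key : ∀ i ≤ n, ∃ u, IsLiftOn A γ.toFun γ.a (t i) u ∧ u γ.a = p := by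
    intro i hi
    induction i with
    | zero =>
      rw [h0]
      exact exists_lift_refl A (hp.trans γ.source.symm)
    | succ i ih =>
      obtain ⟨u, hu, hu0⟩ := ih (by omega)
      have hai : γ.a ≤ t i := h0 ▸ hmono (Nat.zero_le i)
      obtain ⟨v, hv, hv0⟩ := exists_lift_of_contMDiffOn hG A (hmono i.le_succ)
        ((hpc i (by omega)).of_le (by simp)) (u (t i)) (hu.1 _ ⟨hai, le_rfl⟩)
      exact ⟨_, hu.concat hai (hmono i.le_succ) hv hv0.symm, by rw [if_pos hai, hu0]⟩
  have := key n le_rfl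
  rwa [hn] at this

/-- Lifts exist, so the predicate behind `Classical.epsilon` is satisfiable and the chosen element
satisfies it. -/
lemma holonomy_spec (hG : IsU1OrSU2 G) (A : Connection B) (u₀ : P) (γ : PLoop E (B.proj u₀)) :
    ∃ u, IsLiftOn A γ.toFun γ.a γ.b u ∧ u γ.a = u₀ ∧ u₀ = B.act (u γ.b) (holonomy A u₀ γ) := by
  obtain ⟨u, hu, hu0⟩ := exists_lift_loop hG A γ (p := u₀) rfl
  obtain ⟨g, hg, -⟩ := B.existsUnique_act (u γ.b) u₀
    (by rw [hu.1 _ ⟨γ.le, le_rfl⟩, γ.target])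
  exact Classical.epsilon_spec (p := fun g : G => ∃ u : ℝ → P, IsHorizontalLift A γ u ∧
    u γ.a = u₀ ∧ u₀ = B.act (u γ.b) g) ⟨g, u, hu, hu0, hg.symm⟩

/-- Lifts are unique and the action is free, so any one lift computes the holonomy. -/
lemma holonomy_eq (hG : IsU1OrSU2 G) {A : Connection B} {u₀ : P} {γ : PLoop E (B.proj u₀)}
    {u : ℝ → P} (hu : IsLiftOn A γ.toFun γ.a γ.b u) (hu0 : u γ.a = u₀) {g : G}
    (hg : u₀ = B.act (u γ.b) g) : holonomy A u₀ γ = g := by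
  obtain ⟨v, hv, hv0, hvg⟩ := holonomy_spec hG A u₀ γ
  have huv : v γ.b = u γ.b :=
    hv.eq_right_of_eq_left γ.le γ.continuousOn hu (hv0.trans hu0.symm)
  rw [huv] at hvg
  exact (B.existsUnique_act (u γ.b) u₀ (by rw [hu.1 _ ⟨γ.le, le_rfl⟩, γ.target])).unique
    hvg.symm hg.symm

/-- The constant loop. -/
def PLoop.const (x₀ : M) : PLoop E x₀ where
  toFun _ := x₀
  a := 0
  b := 0
  le := le_rfl
  continuousOn := continuousOn_const
  piecewise_analytic := ⟨0, fun _ => 0, monotone_const, rfl, rfl, fun i hi => by omega⟩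
  source := rfl
  target := rfl

lemma contMDiff_affine (ε d : ℝ) : ContMDiff 𝓘(ℝ, ℝ) 𝓘(ℝ, ℝ) ω fun t : ℝ => ε * t + d :=
  contMDiff_iff_contDiff.2 (by fun_prop)

/-- The inverse of a loop. -/
def PLoop.inv {x₀ : M} (γ : PLoop E x₀) : PLoop E x₀ where
  toFun t := γ.toFun (-1 * t + (γ.a + γ.b))
  a := γ.a
  b := γ.b
  le := γ.le
  continuousOn := γ.continuousOn.comp (by fun_prop) fun t ht => by
    rw [mem_Icc] at ht ⊢; constructor <;> linarith [ht.1, ht.2]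
  piecewise_analytic := by
    obtain ⟨n, t, hmono, h0, hn, hpc⟩ := γ.piecewise_analytic
    -- Truncated subtraction makes the reflected partition constant, equal to `b`, beyond the index
    -- `n`, so it is monotone on all of `ℕ`.
    refine ⟨n, fun i => γ.a + γ.b - t (n - i), fun i j hij => ?_, by simp [hn], by simp [h0],
      fun i hi => ?_⟩
    · have := hmono (show n - j ≤ n - i by omega)
      simp only
      linarith
    · have h1 := hpc (n - (i + 1)) (by omega)
      rw [show n - (i + 1) + 1 = n - i by omega] at h1
      refine h1.comp (contMDiff_affine (-1) (γ.a + γ.b)).contMDiffOn fun τ hτ => ?_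
      rw [mem_Icc] at hτ
      rw [mem_preimage, mem_Icc]
      constructor <;> linarith [hτ.1, hτ.2]
  source := by rw [show -1 * γ.a + (γ.a + γ.b) = γ.b by ring]; exact γ.target
  target := by rw [show -1 * γ.b + (γ.a + γ.b) = γ.a by ring]; exact γ.source

/-- The underlying function of the concatenation of two loops. -/
def PLoop.concatFun {x₀ : M} (γ δ : PLoop E x₀) (t : ℝ) : M :=
  if t ≤ γ.b then γ.toFun t else δ.toFun (1 * t + (δ.a - γ.b))

lemma PLoop.concatFun_eqOn_left {x₀ : M} (γ δ : PLoop E x₀) :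
    EqOn (γ.concatFun δ) γ.toFun (Iic γ.b) := fun _ ht => if_pos ht

lemma PLoop.concatFun_eqOn_right {x₀ : M} (γ δ : PLoop E x₀) :
    EqOn (γ.concatFun δ) (fun t => δ.toFun (1 * t + (δ.a - γ.b))) (Ici γ.b) := by
  intro t ht
  rcases eq_or_lt_of_le (show γ.b ≤ t from ht) with rfl | hlt
  · rw [γ.concatFun_eqOn_left δ self_mem_Iic, γ.target]
    change x₀ = δ.toFun (1 * γ.b + (δ.a - γ.b))
    rw [show 1 * γ.b + (δ.a - γ.b) = δ.a by ring, δ.source]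
  · exact if_neg hlt.not_ge

/-- The concatenation of two loops. -/
def PLoop.mul {x₀ : M} (γ δ : PLoop E x₀) : PLoop E x₀ where
  toFun := γ.concatFun δ
  a := γ.a
  b := γ.b + (δ.b - δ.a)
  le := by linarith [γ.le, δ.le]
  continuousOn := by
    have h1 : ContinuousOn (γ.concatFun δ) (Icc γ.a γ.b) :=
      γ.continuousOn.congr fun t ht => γ.concatFun_eqOn_left δ ht.2
    have h2 : ContinuousOn (γ.concatFun δ) (Icc γ.b (γ.b + (δ.b - δ.a))) := by
      refine ContinuousOn.congr (f := fun t => δ.toFun (1 * t + (δ.a - γ.b)))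
        (δ.continuousOn.comp (by fun_prop) fun t ht => ?_)
        fun t ht => γ.concatFun_eqOn_right δ ht.1
      rw [mem_Icc] at ht ⊢
      constructor <;> linarith [ht.1, ht.2]
    rw [← Icc_union_Icc_eq_Icc γ.le (by linarith [δ.le] : γ.b ≤ γ.b + (δ.b - δ.a))]
    exact h1.union_of_isClosed h2 isClosed_Icc isClosed_Icc
  piecewise_analytic := by
    obtain ⟨n, t, hmono, h0, hn, hpc⟩ := γ.piecewise_analytic
    obtain ⟨m, r, hmono', h0', hm, hpc'⟩ := δ.piecewise_analytic
    -- The shift `γ.b - δ.a` moves `δ.a` to `γ.b`, so both formulas agree at `i = n`.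
    refine ⟨n + m, fun i => if i ≤ n then t i else r (i - n) + (γ.b - δ.a), ?_, ?_, ?_, ?_⟩
    · refine monotone_nat_of_le_succ fun i => ?_
      have h3 := hmono i.le_succ
      rcases lt_trichotomy i n with h | rfl | h
      · simp [h.le, Nat.succ_le_of_lt h, h3]
      · have := hmono' (zero_le (a := 1))
        simp [hn]
        linarith
      · have := hmono' (show i - n ≤ i + 1 - n by omega)
        simp [show ¬ i ≤ n by omega, show ¬ i + 1 ≤ n by omega, this]
    · simp [h0]
    · rcases Nat.eq_zero_or_pos m with rfl | hm0
      · simp [hn]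
        linarith
      · simp [show ¬ m = 0 by omega, hm]
        ring
    · intro i hi
      rcases lt_or_ge i n with h | h
      · simp only [h.le, Nat.succ_le_of_lt h, if_true]
        refine (hpc i h).congr fun τ hτ => γ.concatFun_eqOn_left δ ?_
        exact hτ.2.trans (hn ▸ hmono (Nat.succ_le_of_lt h))
      · have hl : (if i ≤ n then t i else r (i - n) + (γ.b - δ.a)) = r (i - n) + (γ.b - δ.a) := by
          split_ifs with h'
          · obtain rfl : i = n := by omega
            simp [hn, h0']
          · rfl
        simp only [hl]
        rw [if_neg (by omega), show i + 1 - n = i - n + 1 by omega]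
        have h4 := hpc' (i - n) (by omega)
        have h5 : δ.a ≤ r (i - n) := h0' ▸ hmono' (Nat.zero_le _)
        refine ContMDiffOn.congr (f := fun t => δ.toFun (1 * t + (δ.a - γ.b)))
          (h4.comp (contMDiff_affine 1 (δ.a - γ.b)).contMDiffOn fun τ hτ => ?_)
          fun τ hτ => γ.concatFun_eqOn_right δ ?_
        · rw [mem_Icc] at hτ
          rw [mem_preimage, mem_Icc]
          constructor <;> linarith [hτ.1, hτ.2]
        · have := hτ.1
          rw [mem_Ici]
          linarith
  source := by rw [γ.concatFun_eqOn_left δ γ.le, γ.source]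
  target := by
    rw [γ.concatFun_eqOn_right δ (by rw [mem_Ici]; linarith [δ.le])]
    change δ.toFun (1 * (γ.b + (δ.b - δ.a)) + (δ.a - γ.b)) = x₀
    rw [show 1 * (γ.b + (δ.b - δ.a)) + (δ.a - γ.b) = δ.b by ring, δ.target]

lemma holonomy_const (hG : IsU1OrSU2 G) (A : Connection B) (u₀ : P) :
    holonomy A u₀ (PLoop.const (E := E) (B.proj u₀)) = 1 := by
  obtain ⟨u, hu, hu0, hg⟩ := holonomy_spec hG A u₀ (PLoop.const (E := E) (B.proj u₀))
  refine holonomy_eq hG hu hu0 ?_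
  rw [B.act_one]
  exact hu0.symm

/-- If `u` lifts `γ` from `u₀` with holonomy `H`, then `u H`, run backwards, starts at `u(b) H = u₀`
and ends at `u₀ H`. -/
lemma holonomy_inv (hG : IsU1OrSU2 G) (A : Connection B) (u₀ : P) (γ : PLoop E (B.proj u₀)) :
    holonomy A u₀ γ.inv = (holonomy A u₀ γ)⁻¹ := by
  obtain ⟨u, hu, hu0, hg⟩ := holonomy_spec hG A u₀ γ
  have h1 := (hu.act γ.continuousOn (holonomy A u₀ γ)).comp_affine (a' := γ.a) (b' := γ.b)
    γ.isPiecewiseDiff (-1) (γ.a + γ.b) (by norm_num)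
    (fun t ht => by rw [mem_Icc] at ht ⊢; constructor <;> linarith [ht.1, ht.2])
    (fun t ht => by rw [mem_Ioo] at ht ⊢; constructor <;> linarith [ht.1, ht.2])
  refine holonomy_eq hG h1 ?_ ?_
  · change B.act (u (-1 * γ.a + (γ.a + γ.b))) _ = u₀
    rw [show -1 * γ.a + (γ.a + γ.b) = γ.b by ring, ← hg]
  · change u₀ = B.act (B.act (u (-1 * γ.b + (γ.a + γ.b))) _) _
    rw [show -1 * γ.b + (γ.a + γ.b) = γ.a by ring, hu0, ← B.act_mul, mul_inv_cancel, B.act_one]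

/-- The lift of `γ` ends at `u₀ g⁻¹`, and the lift `v` of `δ` translated by `g⁻¹` continues it. The
end point is `v(b) g⁻¹`, and `u₀ = v(b) h = (v(b) g⁻¹)(g h)`. -/
lemma holonomy_mul (hG : IsU1OrSU2 G) (A : Connection B) (u₀ : P) (γ δ : PLoop E (B.proj u₀)) :
    holonomy A u₀ (γ.mul δ) = holonomy A u₀ γ * holonomy A u₀ δ := by
  obtain ⟨u, hu, hu0, hg⟩ := holonomy_spec hG A u₀ γ
  obtain ⟨v, hv, hv0, hg'⟩ := holonomy_spec hG A u₀ δ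
  set g := holonomy A u₀ γ
  set h := holonomy A u₀ δ
  have hgb : B.act u₀ g⁻¹ = u γ.b := by
    nth_rewrite 1 [hg]
    rw [← B.act_mul, mul_inv_cancel, B.act_one]
  have hle : γ.b ≤ γ.b + (δ.b - δ.a) := by linarith [δ.le]
  have h1 : IsLiftOn A (γ.concatFun δ) γ.a γ.b u :=
    hu.congr (fun t ht => (γ.concatFun_eqOn_left δ ht.2).symm) fun _ _ => rfl
  have h2 := (hv.act δ.continuousOn g⁻¹).comp_affine (a' := γ.b) (b' := γ.b + (δ.b - δ.a))
    δ.isPiecewiseDiff 1 (δ.a - γ.b) one_ne_zero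
    (fun t ht => by rw [mem_Icc] at ht ⊢; constructor <;> linarith [ht.1, ht.2])
    (fun t ht => by rw [mem_Ioo] at ht ⊢; constructor <;> linarith [ht.1, ht.2])
  have h3 : IsLiftOn A (γ.concatFun δ) γ.b (γ.b + (δ.b - δ.a))
      (fun t => B.act (v (1 * t + (δ.a - γ.b))) g⁻¹) :=
    h2.congr (fun t ht => (γ.concatFun_eqOn_right δ ht.1).symm) fun _ _ => rfl
  have hm : B.act (v (1 * γ.b + (δ.a - γ.b))) g⁻¹ = u γ.b := by
    rw [show 1 * γ.b + (δ.a - γ.b) = δ.a by ring, hv0, hgb]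
  have hend : B.act (v (1 * (γ.b + (δ.b - δ.a)) + (δ.a - γ.b))) g⁻¹ =
      B.act (v δ.b) g⁻¹ := by
    rw [show 1 * (γ.b + (δ.b - δ.a)) + (δ.a - γ.b) = δ.b by ring]
  have h5 := h1.concat γ.le hle h3 hm.symm
  refine holonomy_eq (γ := γ.mul δ) hG h5 ?_ ?_
  · exact (if_pos γ.le).trans hu0
  -- If the parameter interval of `δ` is a point, the end falls in the first branch and has to be
  -- identified separately.
  · have h4 : (if γ.b + (δ.b - δ.a) ≤ γ.b then u (γ.b + (δ.b - δ.a)) else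
        B.act (v (1 * (γ.b + (δ.b - δ.a)) + (δ.a - γ.b))) g⁻¹) = B.act (v δ.b) g⁻¹ := by
      split_ifs with hcase
      · have hb : γ.b + (δ.b - δ.a) = γ.b := le_antisymm hcase hle
        have hb' : δ.b = δ.a := by linarith
        rw [hb, hb', hv0, hgb]
      · exact hend
    change u₀ = B.act (if γ.b + (δ.b - δ.a) ≤ γ.b then u (γ.b + (δ.b - δ.a)) else
        B.act (v (1 * (γ.b + (δ.b - δ.a)) + (δ.a - γ.b))) g⁻¹) (g * h)
    rw [h4, ← B.act_mul, inv_mul_cancel_left]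
    exact hg'

end Loops

/-! ### Sections of the associated line bundle without zeros on finitely many arcs -/

section LineSections

variable {E : Type*} [NormedAddCommGroup E] [NormedSpace ℝ E]
  {M : Type*} [TopologicalSpace M] [ChartedSpace E M] [IsManifold 𝓘(ℝ, E) ω M] {P : Type*}

/-- The complex number given by an element of `U(1)`. -/
def phase (g : (⊤ : Subgroup (Matrix.unitaryGroup (Fin 1) ℂ))) : ℂ := mat g 0 0

lemma phase_mul (g h : (⊤ : Subgroup (Matrix.unitaryGroup (Fin 1) ℂ))) :
    phase (g * h) = phase g * phase h := by
  simp [phase, mat_mul, Matrix.mul_apply]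

lemma star_phase_mul (g : (⊤ : Subgroup (Matrix.unitaryGroup (Fin 1) ℂ))) :
    star (phase g) * phase g = 1 := by
  have := congrFun (congrFun (mat_conjTranspose_mul g) 0) 0
  simpa [phase, Matrix.mul_apply] using this

lemma phase_inv (g : (⊤ : Subgroup (Matrix.unitaryGroup (Fin 1) ℂ))) :
    phase g⁻¹ = star (phase g) := by
  simp [phase, mat_inv]

lemma phase_ne_zero (g : (⊤ : Subgroup (Matrix.unitaryGroup (Fin 1) ℂ))) : phase g ≠ 0 := by
  intro h
  simpa [h] using star_phase_mul g

lemma phase_injective : Function.Injective phase := fun g h hgh => by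
  refine mat_injective ?_
  ext i j
  rw [Fin.fin_one_eq_zero i, Fin.fin_one_eq_zero j]
  exact hgh

lemma exists_phase_eq {w : ℂ} (hw : star w * w = 1) : ∃ g, phase g = w := by
  refine ⟨⟨⟨Matrix.of fun _ _ => w, Matrix.mem_unitaryGroup_iff'.2 ?_⟩, trivial⟩, rfl⟩
  ext i j
  rw [Fin.fin_one_eq_zero i, Fin.fin_one_eq_zero j]
  simpa [Matrix.mul_apply, Matrix.star_apply] using hw

lemma contMDiffWithinAt_mul {F H Q : Type*} [NormedAddCommGroup F] [NormedSpace ℝ F]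
    [TopologicalSpace H] {I : ModelWithCorners ℝ F H} [TopologicalSpace Q] [ChartedSpace H Q]
    {n : WithTop ℕ∞} {f g : Q → ℂ} {s : Set Q} {x : Q}
    (hf : ContMDiffWithinAt I 𝓘(ℝ, ℂ) n f s x) (hg : ContMDiffWithinAt I 𝓘(ℝ, ℂ) n g s x) :
    ContMDiffWithinAt I 𝓘(ℝ, ℂ) n (fun y => f y * g y) s x :=
  ((contDiff_mul (𝕜 := ℝ) (𝔸 := ℂ)).contMDiff.contMDiffAt).comp_contMDiffWithinAt x
    (hf.prodMk_space hg)

variable {B : PrincipalBundle (⊤ : Subgroup (Matrix.unitaryGroup (Fin 1) ℂ)) E M P}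

/-- A smooth section of the complex line bundle associated with a `U(1)`-bundle, given by its
components in the local trivializations. -/
structure IsSection (B : PrincipalBundle (⊤ : Subgroup (Matrix.unitaryGroup (Fin 1) ℂ)) E M P)
    (f : B.ι → M → ℂ) : Prop where
  smooth : ∀ i, ContMDiffOn 𝓘(ℝ, E) 𝓘(ℝ, ℂ) ∞ (f i) (B.dom i)
  trans : ∀ i j, ∀ x ∈ B.dom i, x ∈ B.dom j → f i x = phase (B.trans i j x) * f j x

lemma trans_mul {N : ℕ} {G : Subgroup (Matrix.unitaryGroup (Fin N) ℂ)}
    (B : PrincipalBundle G E M P) {i j k : B.ι} {x : M}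
    (hi : x ∈ B.dom i) (hj : x ∈ B.dom j) (hk : x ∈ B.dom k) :
    B.trans i k x = B.trans i j x * B.trans j k x := by
  obtain ⟨p, rfl⟩ := B.proj_surjective x
  have h1 := B.coord_eq i k p hi hk
  rw [B.coord_eq i j p hi hj, B.coord_eq j k p hj hk, ← mul_assoc] at h1
  exact (mul_right_cancel h1).symm

lemma smooth_phase_trans (B : PrincipalBundle (⊤ : Subgroup (Matrix.unitaryGroup (Fin 1) ℂ)) E M P)
    (i j : B.ι) : ContMDiffOn 𝓘(ℝ, E) 𝓘(ℝ, ℂ) ∞ (fun x => phase (B.trans i j x))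
      (B.dom i ∩ B.dom j) := B.smooth_trans i j 0 0

lemma IsSection.add {f g : B.ι → M → ℂ} (hf : IsSection B f) (hg : IsSection B g) :
    IsSection B fun i x => f i x + g i x where
  smooth i := (hf.smooth i).add (hg.smooth i)
  trans i j x hi hj := by rw [hf.trans i j x hi hj, hg.trans i j x hi hj]; ring

lemma contMDiff_ofReal {ρ : M → ℝ} (hρ : ContMDiff 𝓘(ℝ, E) 𝓘(ℝ, ℝ) ∞ ρ) :
    ContMDiff 𝓘(ℝ, E) 𝓘(ℝ, ℂ) ∞ fun x => (ρ x : ℂ) :=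
  (Complex.ofRealCLM.contDiff.contMDiff).comp hρ

lemma IsSection.mul_left {f : B.ι → M → ℂ} (hf : IsSection B f) {r : M → ℂ}
    (hr : ContMDiff 𝓘(ℝ, E) 𝓘(ℝ, ℂ) ∞ r) : IsSection B fun i x => r x * f i x where
  smooth i x hx := contMDiffWithinAt_mul hr.contMDiffAt.contMDiffWithinAt (hf.smooth i x hx)
  trans i j x hi hj := by rw [hf.trans i j x hi hj]; ring

/-- The section supported in the domain of a trivialization given by a bump function. -/
lemma isSection_bump {ρ : M → ℝ} (hρ : ContMDiff 𝓘(ℝ, E) 𝓘(ℝ, ℝ) ∞ ρ) {k : B.ι}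
    (hk : tsupport ρ ⊆ B.dom k) :
    IsSection B fun i x => (ρ x : ℂ) * phase (B.trans i k x) where
  smooth i := by
    intro x hx
    by_cases hxk : x ∈ tsupport ρ
    · refine contMDiffWithinAt_mul (contMDiff_ofReal hρ).contMDiffAt.contMDiffWithinAt ?_
      exact ((smooth_phase_trans B i k).contMDiffAt
        (((B.isOpen_dom i).inter (B.isOpen_dom k)).mem_nhds ⟨hx, hk hxk⟩)).contMDiffWithinAt
    · refine ContMDiffAt.contMDiffWithinAt ?_
      refine (contMDiffAt_const (c := (0 : ℂ))).congr_of_eventuallyEq ?_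
      filter_upwards [(isClosed_tsupport ρ).isOpen_compl.mem_nhds hxk] with y hy
      rw [image_eq_zero_of_notMem_tsupport hy]
      simp
  trans i j x hi hj := by
    by_cases hxk : x ∈ tsupport ρ
    · rw [trans_mul B hi hj (hk hxk), phase_mul]
      ring
    · rw [image_eq_zero_of_notMem_tsupport hxk]
      simp

lemma exists_bump [FiniteDimensional ℝ E] [T2Space M] {x : M} {U : Set M} (hU : U ∈ nhds x) :
    ∃ ρ : M → ℝ, ContMDiff 𝓘(ℝ, E) 𝓘(ℝ, ℝ) ∞ ρ ∧ tsupport ρ ⊆ U ∧ ρ x ≠ 0 := by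
  have : IsManifold 𝓘(ℝ, E) ∞ M := IsManifold.of_le (n := ω) le_top
  obtain ⟨f, -, hf⟩ := (SmoothBumpFunction.nhds_basis_tsupport (I := 𝓘(ℝ, E)) x).mem_iff.1 hU
  exact ⟨f, f.contMDiff, hf, by rw [f.eq_one]; exact one_ne_zero⟩

/-- A finite family of `C¹` arcs. -/
structure IsArcFamily (E : Type*) [NormedAddCommGroup E] [NormedSpace ℝ E]
    {M : Type*} [TopologicalSpace M] [ChartedSpace E M]
    {J : Type*} (c : J → ℝ → M) (s t : J → ℝ) : Prop where
  contMDiffOn : ∀ j, ContMDiffOn 𝓘(ℝ, ℝ) 𝓘(ℝ, E) 1 (c j) (Icc (s j) (t j))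

/-- A generic multiple of `r` can be added to `f` so that the sum has no zeros on the arcs where
`r` does not vanish. -/
lemma exists_notMem_quotient {J : Type*} [Countable J] {c : J → ℝ → M} {s t : J → ℝ}
    (hc : IsArcFamily E c s t) {U : Set M} (hU : IsOpen U) {f r : M → ℂ}
    (hf : ContMDiffOn 𝓘(ℝ, E) 𝓘(ℝ, ℂ) ∞ f U) (hr : ContMDiffOn 𝓘(ℝ, E) 𝓘(ℝ, ℂ) ∞ r U) :
    ∃ z : ℂ, ∀ j, ∀ τ ∈ Icc (s j) (t j), c j τ ∈ U → r (c j τ) ≠ 0 →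
      f (c j τ) + z * r (c j τ) ≠ 0 := by
  set S : J → Set ℝ := fun j => {τ ∈ Icc (s j) (t j) | c j τ ∈ U ∧ r (c j τ) ≠ 0}
  set φ : J → ℝ → ℂ := fun j τ => -(f (c j τ) / r (c j τ))
  -- For `r ≠ 0` the forbidden values of `z` are exactly the values of `-f / r` along the arcs.
  -- These are images of subsets of the line under locally Lipschitz maps, of Hausdorff dimension at
  -- most one, and countably many of them cannot fill `ℂ`.
  have hdim : ∀ j, dimH (φ j '' S j) ≤ 1 := by
    intro j
    refine (dimH_image_le_of_locally_lipschitzOn fun τ hτ => ?_).trans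
      ((dimH_mono (subset_univ _)).trans Real.dimH_univ.le)
    have hfc : ContDiffWithinAt ℝ 1 (fun τ => f (c j τ)) (Icc (s j) (t j)) τ :=
      contMDiffWithinAt_iff_contDiffWithinAt.1 <| ContMDiffAt.comp_contMDiffWithinAt τ
        ((hf.contMDiffAt (hU.mem_nhds hτ.2.1)).of_le (by simp)) (hc.contMDiffOn j τ hτ.1)
    have hrc : ContDiffWithinAt ℝ 1 (fun τ => r (c j τ)) (Icc (s j) (t j)) τ :=
      contMDiffWithinAt_iff_contDiffWithinAt.1 <| ContMDiffAt.comp_contMDiffWithinAt τ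
        ((hr.contMDiffAt (hU.mem_nhds hτ.2.1)).of_le (by simp)) (hc.contMDiffOn j τ hτ.1)
    have hφ : ContDiffWithinAt ℝ 1 (φ j) (Icc (s j) (t j)) τ := by
      simp only [φ, div_eq_mul_inv]
      exact (hfc.mul (hrc.inv hτ.2.2)).neg
    obtain ⟨K, V, hV, hK⟩ := hφ.exists_lipschitzOnWith (convex_Icc _ _)
    exact ⟨K, V, nhdsWithin_mono _ (fun σ hσ => hσ.1) hV, hK⟩
  have hlt : dimH (⋃ j, φ j '' S j) < Module.finrank ℝ ℂ := by
    rw [dimH_iUnion, Complex.finrank_real_complex]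
    exact (iSup_le hdim).trans_lt (by norm_num)
  obtain ⟨z, hz⟩ := (dense_compl_of_dimH_lt_finrank hlt).nonempty
  refine ⟨z, fun j τ hτ hU hr0 h0 => hz (mem_iUnion.2 ⟨j, τ, ⟨hτ, hU, hr0⟩, ?_⟩)⟩
  simp only [φ]
  field_simp
  linear_combination -h0

variable [FiniteDimensional ℝ E] [T2Space M]

/-- A line bundle has a smooth section without zeros on a finite family of arcs. -/
lemma exists_section_ne_zero {J : Type*} [Finite J] {c : J → ℝ → M} {s t : J → ℝ}
    (hc : IsArcFamily E c s t) :
    ∃ f, IsSection B f ∧ ∀ j, ∀ τ ∈ Icc (s j) (t j), ∀ i, c j τ ∈ B.dom i → f i (c j τ) ≠ 0 := by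
  have hb : ∀ x : M, ∃ (k : B.ι) (ρ : M → ℝ), ContMDiff 𝓘(ℝ, E) 𝓘(ℝ, ℝ) ∞ ρ ∧
      tsupport ρ ⊆ B.dom k ∧ ρ x ≠ 0 := fun x => by
    obtain ⟨k, hk⟩ := B.cover x
    exact ⟨k, exists_bump ((B.isOpen_dom k).mem_nhds hk)⟩
  choose k ρ hρ hρk hρx using hb
  have hK : IsCompact (⋃ j, c j '' Icc (s j) (t j)) :=
    isCompact_iUnion fun j => isCompact_Icc.image_of_continuousOn (hc.contMDiffOn j).continuousOn
  obtain ⟨F, hF⟩ := hK.elim_finite_subcover (fun x => {y | ρ x y ≠ 0})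
    (fun x => (hρ x).continuous.isOpen_preimage _ isOpen_ne) fun x _ => mem_iUnion.2 ⟨x, hρx x⟩
  -- Bump sections are added one at a time with generic coefficients. Where the new bump is
  -- non-zero, genericity avoids zeros; where it vanishes, the sum is the old section.
  have key : ∀ F : Finset M, ∃ f, IsSection B f ∧ ∀ j, ∀ τ ∈ Icc (s j) (t j),
      (∃ x ∈ F, ρ x (c j τ) ≠ 0) → ∀ i, c j τ ∈ B.dom i → f i (c j τ) ≠ 0 := by
    classical
    intro F
    induction F using Finset.induction_on with
    | empty =>
      refine ⟨fun _ _ => 0, ⟨fun i => contMDiffOn_const, fun i j x _ _ => by simp⟩, ?_⟩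
      rintro j τ - ⟨x, hx, -⟩
      simp at hx
    | insert x F _ ih =>
      obtain ⟨f, hf, hf0⟩ := ih
      obtain ⟨z, hz⟩ := exists_notMem_quotient hc (B.isOpen_dom (k x)) (hf.smooth (k x))
        (contMDiff_ofReal (hρ x)).contMDiffOn
      refine ⟨_, hf.add ((isSection_bump (hρ x) (hρk x)).mul_left
        (contMDiff_const (c := z))), fun j τ hτ hx i hi => ?_⟩
      by_cases h0 : ρ x (c j τ) = 0
      · simp only [h0, Complex.ofReal_zero, zero_mul, mul_zero, add_zero]
        refine hf0 j τ hτ ?_ i hi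
        obtain ⟨y, hy, hy0⟩ := hx
        rcases Finset.mem_insert.1 hy with rfl | hy
        · exact absurd h0 hy0
        · exact ⟨y, hy, hy0⟩
      · have hk : c j τ ∈ B.dom (k x) := hρk x (subset_tsupport _ h0)
        have h1 := hz j τ hτ hk (by simpa using h0)
        rw [hf.trans i (k x) _ hi hk]
        rw [show phase (B.trans i (k x) (c j τ)) * f (k x) (c j τ) +
          z * ((ρ x (c j τ) : ℂ) * phase (B.trans i (k x) (c j τ))) =
          phase (B.trans i (k x) (c j τ)) * (f (k x) (c j τ) + z * (ρ x (c j τ) : ℂ)) by ring]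
        exact mul_ne_zero (phase_ne_zero _) h1
  obtain ⟨f, hf, hf0⟩ := key F
  refine ⟨f, hf, fun j τ hτ i hi => hf0 j τ hτ ?_ i hi⟩
  have := hF (mem_iUnion.2 ⟨j, τ, hτ, rfl⟩)
  simpa using this

/-- A smooth function on the real line that equals `1 / √r` for `r ≥ δ`. -/
lemma exists_smooth_inv_sqrt {δ : ℝ} (hδ : 0 < δ) :
    ∃ ψ : ℝ → ℝ, ContDiff ℝ ∞ ψ ∧ ∀ r, δ ≤ r → ψ r = 1 / √r := by
  -- The argument `2 r / δ - 1` makes the cutoff zero for `r ≤ δ / 2`, away from which `1 / √r` is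
  -- smooth, and one for `r ≥ δ`.
  refine ⟨fun r => Real.smoothTransition (2 * r / δ - 1) / √r, ?_, fun r hr => ?_⟩
  · refine contDiff_iff_contDiffAt.2 fun r => ?_
    rcases lt_or_ge r (δ / 2) with h | h
    · refine (contDiffAt_const (c := (0 : ℝ))).congr_of_eventuallyEq ?_
      filter_upwards [gt_mem_nhds h] with y hy
      rw [Real.smoothTransition.zero_of_nonpos, zero_div]
      rw [sub_nonpos, div_le_one hδ]
      linarith
    · have hr : 0 < r := by linarith
      refine ContDiffAt.div ?_ ((contDiffAt_id).sqrt hr.ne') (Real.sqrt_ne_zero'.2 hr)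
      exact (Real.smoothTransition.contDiff.comp (by fun_prop)).contDiffAt
  · simp only
    rw [Real.smoothTransition.one_of_one_le]
    rw [le_sub_iff_add_le, le_div_iff₀ hδ]
    linarith

/-- A line bundle has a smooth section of norm one on a finite family of arcs. -/
lemma exists_section_norm_one {J : Type*} [Finite J] {c : J → ℝ → M} {s t : J → ℝ}
    (hc : IsArcFamily E c s t) :
    ∃ f, IsSection B f ∧ ∀ j, ∀ τ ∈ Icc (s j) (t j), ∀ i, c j τ ∈ B.dom i →
      star (f i (c j τ)) * f i (c j τ) = 1 := by
  obtain ⟨f, hf, hf0⟩ := exists_section_ne_zero (B := B) hc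
  choose i₀ hi₀ using B.cover
  -- The transition functions have modulus one, so `|f|²` is a global smooth function, bounded below
  -- by some `δ > 0` on the compact union of the arcs. Multiplying `f` by a smooth function of it
  -- that equals `1 / √R` there normalizes `f` on the arcs.
  set R : M → ℝ := fun x => Complex.normSq (f (i₀ x) x)
  have hR : ∀ i, ∀ x ∈ B.dom i, R x = Complex.normSq (f i x) := by
    intro i x hi
    have h1 : Complex.normSq (phase (B.trans (i₀ x) i x)) = 1 := by
      have := star_phase_mul (B.trans (i₀ x) i x)
      rw [RCLike.star_def, mul_comm, Complex.mul_conj] at this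
      exact_mod_cast this
    simp only [R]
    rw [hf.trans (i₀ x) i x (hi₀ x) hi, Complex.normSq_mul, h1, one_mul]
  have hns : ContDiff ℝ ∞ Complex.normSq := by
    have : (Complex.normSq : ℂ → ℝ) = fun z => z.re * z.re + z.im * z.im :=
      funext Complex.normSq_apply
    rw [this]
    exact (Complex.reCLM.contDiff.mul Complex.reCLM.contDiff).add
      (Complex.imCLM.contDiff.mul Complex.imCLM.contDiff)
  have hRs : ContMDiff 𝓘(ℝ, E) 𝓘(ℝ, ℝ) ∞ R := by
    intro x
    have hn := (B.isOpen_dom (i₀ x)).mem_nhds (hi₀ x)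
    have h1 : ContMDiffAt 𝓘(ℝ, E) 𝓘(ℝ, ℝ) ∞ (fun y => Complex.normSq (f (i₀ x) y)) x :=
      hns.contMDiff.contMDiffAt.comp x ((hf.smooth (i₀ x)).contMDiffAt hn)
    exact h1.congr_of_eventuallyEq (Filter.eventually_of_mem hn fun y hy => hR _ y hy)
  have hK : IsCompact (⋃ j, c j '' Icc (s j) (t j)) :=
    isCompact_iUnion fun j => isCompact_Icc.image_of_continuousOn (hc.contMDiffOn j).continuousOn
  obtain ⟨δ, hδ, hδR⟩ : ∃ δ : ℝ, 0 < δ ∧ ∀ x ∈ ⋃ j, c j '' Icc (s j) (t j), δ ≤ R x := by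
    refine hK.exists_forall_le' hRs.continuous.continuousOn fun x hx => ?_
    obtain ⟨j, τ, hτ, rfl⟩ := mem_iUnion.1 hx
    exact Complex.normSq_pos.2 (hf0 j τ hτ _ (hi₀ _))
  obtain ⟨ψ, hψ, hψδ⟩ := exists_smooth_inv_sqrt hδ
  refine ⟨_, hf.mul_left (contMDiff_ofReal (hψ.contMDiff.comp hRs)), fun j τ hτ i hi => ?_⟩
  have h1 := hδR (c j τ) (mem_iUnion.2 ⟨j, τ, hτ, rfl⟩)
  have h2 := hR i (c j τ) hi
  have h3 : 0 < R (c j τ) := hδ.trans_le h1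
  rw [RCLike.star_def, mul_comm, Complex.mul_conj, Complex.normSq_mul, Complex.normSq_ofReal,
    ← h2]
  simp only [Function.comp_apply]
  rw [hψδ _ h1, div_mul_div_comm, one_mul, Real.mul_self_sqrt h3.le, one_div,
    inv_mul_cancel₀ h3.ne', Complex.ofReal_one]

end LineSections

/-! ### Reflecting a `U(1)`-connection in a section to invert holonomies -/

section Conjugation

variable {E : Type*} [NormedAddCommGroup E] [NormedSpace ℝ E]
  {M : Type*} [TopologicalSpace M] [ChartedSpace E M] [IsManifold 𝓘(ℝ, E) ω M] {P : Type*}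
  {B : PrincipalBundle (⊤ : Subgroup (Matrix.unitaryGroup (Fin 1) ℂ)) E M P}

lemma matrix_one_ext {X Y : Matrix (Fin 1) (Fin 1) ℂ} (h : X 0 0 = Y 0 0) : X = Y := by
  ext i j
  rw [Fin.fin_one_eq_zero i, Fin.fin_one_eq_zero j, h]

lemma mem_lieAlg_top {X : Matrix (Fin 1) (Fin 1) ℂ} (hX : star (X 0 0) = -X 0 0) :
    X ∈ lieAlg (⊤ : Subgroup (Matrix.unitaryGroup (Fin 1) ℂ)) := by
  intro t
  have hskew : (t • X).conjTranspose = -(t • X) := by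
    refine matrix_one_ext ?_
    rw [Matrix.conjTranspose_apply]
    simp only [Matrix.smul_apply, Matrix.neg_apply, star_smul, hX, smul_neg, star_trivial]
  have hunit : (NormedSpace.exp (t • X)).conjTranspose * NormedSpace.exp (t • X) = 1 := by
    have h1 : (NormedSpace.exp (t • X)).conjTranspose = (NormedSpace.exp (t • X))⁻¹ :=
      (Matrix.exp_conjTranspose (t • X)).symm.trans
        ((congrArg NormedSpace.exp hskew).trans (Matrix.exp_neg (t • X)))
    rw [h1]
    exact Matrix.nonsing_inv_mul _ ((Matrix.isUnit_iff_isUnit_det _).1 (Matrix.isUnit_exp (t • X)))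
  exact ⟨⟨⟨_, Matrix.mem_unitaryGroup_iff'.2 hunit⟩, trivial⟩, rfl⟩

lemma star_form (A : Connection B) {i : B.ι} {x : M} (hx : x ∈ B.dom i)
    (v : TangentSpace 𝓘(ℝ, E) x) : star (A.form i x v 0 0) = -A.form i x v 0 0 :=
  congrFun (congrFun (conjTranspose_of_mem_lieAlg (A.form_mem i x hx v)) 0) 0

/-- The differential of a component of a section. -/
def sectionDeriv (f : B.ι → M → ℂ) (i : B.ι) (x : M) (v : TangentSpace 𝓘(ℝ, E) x) : ℂ :=
  mfderiv 𝓘(ℝ, E) 𝓘(ℝ, ℂ) (f i) x v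

lemma sectionDeriv_add (f : B.ι → M → ℂ) (i : B.ι) (x : M) (v w : TangentSpace 𝓘(ℝ, E) x) :
    sectionDeriv f i x (v + w) = sectionDeriv f i x v + sectionDeriv f i x w :=
  map_add (mfderiv 𝓘(ℝ, E) 𝓘(ℝ, ℂ) (f i) x) v w

lemma sectionDeriv_smul (f : B.ι → M → ℂ) (i : B.ι) (x : M) (r : ℝ) (v : TangentSpace 𝓘(ℝ, E) x) :
    sectionDeriv f i x (r • v) = r * sectionDeriv f i x v :=
  map_smul (mfderiv 𝓘(ℝ, E) 𝓘(ℝ, ℂ) (f i) x) r v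

/-- The connection form of `A` reflected in the section `f`. -/
def reflectedValue (A : Connection B) (f : B.ι → M → ℂ) (i : B.ι) (x : M)
    (v : TangentSpace 𝓘(ℝ, E) x) : ℂ :=
  -- With `∇f = df + A f` this is `A - (f̄ ∇f - f conj(∇f))`, so that `A` changes by a globally
  -- defined imaginary form and remains a connection whatever the size of `f`. Along a curve on
  -- which `|f| = 1` it becomes `-A - 2 f̄ df`, which is `-A` in the gauge `f = 1`.
  A.form i x v 0 0 - 2 * (star (f i x) * f i x * A.form i x v 0 0) -
    (star (f i x) * sectionDeriv f i x v - f i x * star (sectionDeriv f i x v))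

lemma contMDiffOn_sectionDeriv {f : B.ι → M → ℂ} (hf : IsSection B f) (i : B.ι) :
    ContMDiffOn (𝓘(ℝ, E)).tangent 𝓘(ℝ, ℂ) ∞
      (fun p : TangentBundle 𝓘(ℝ, E) M => sectionDeriv f i p.1 p.2)
      (Bundle.TotalSpace.proj ⁻¹' B.dom i) := by
  have : IsManifold 𝓘(ℝ, E) 1 M := IsManifold.of_le (n := ω) le_top
  have h1 := (hf.smooth i).contMDiffOn_tangentMapWithin (m := ∞) (by simp)
    (B.isOpen_dom i).uniqueMDiffOn
  have h2 := (contMDiff_snd_tangentBundle_modelSpace (n := ∞) ℂ 𝓘(ℝ, ℂ)).comp_contMDiffOn h1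
  refine h2.congr fun p hp => ?_
  change mfderiv 𝓘(ℝ, E) 𝓘(ℝ, ℂ) (f i) p.1 p.2 =
    mfderivWithin 𝓘(ℝ, E) 𝓘(ℝ, ℂ) (f i) (B.dom i) p.1 p.2
  rw [mfderivWithin_of_isOpen (B.isOpen_dom i) hp]

lemma contMDiffOn_star {F H Q : Type*} [NormedAddCommGroup F] [NormedSpace ℝ F]
    [TopologicalSpace H] {I : ModelWithCorners ℝ F H} [TopologicalSpace Q] [ChartedSpace H Q]
    {n : WithTop ℕ∞} {f : Q → ℂ} {s : Set Q}
    (hf : ContMDiffOn I 𝓘(ℝ, ℂ) n f s) :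
    ContMDiffOn I 𝓘(ℝ, ℂ) n (fun y => star (f y)) s :=
  (Complex.conjCLE.contDiff.contMDiff).comp_contMDiffOn hf

lemma contMDiffOn_mul {F H Q : Type*} [NormedAddCommGroup F] [NormedSpace ℝ F]
    [TopologicalSpace H] {I : ModelWithCorners ℝ F H} [TopologicalSpace Q] [ChartedSpace H Q]
    {n : WithTop ℕ∞} {f g : Q → ℂ} {s : Set Q}
    (hf : ContMDiffOn I 𝓘(ℝ, ℂ) n f s) (hg : ContMDiffOn I 𝓘(ℝ, ℂ) n g s) :
    ContMDiffOn I 𝓘(ℝ, ℂ) n (fun y => f y * g y) s :=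
  fun x hx => contMDiffWithinAt_mul (hf x hx) (hg x hx)

lemma contMDiffOn_reflectedValue (A : Connection B) {f : B.ι → M → ℂ} (hf : IsSection B f)
    (i : B.ι) : ContMDiffOn (𝓘(ℝ, E)).tangent 𝓘(ℝ, ℂ) ∞
      (fun p : TangentBundle 𝓘(ℝ, E) M => reflectedValue A f i p.1 p.2)
      (Bundle.TotalSpace.proj ⁻¹' B.dom i) := by
  have h0 : ContMDiffOn (𝓘(ℝ, E)).tangent 𝓘(ℝ, ℂ) ∞
      (fun p : TangentBundle 𝓘(ℝ, E) M => f i p.1) (Bundle.TotalSpace.proj ⁻¹' B.dom i) :=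
    (hf.smooth i).comp (Bundle.contMDiff_proj (TangentSpace 𝓘(ℝ, E))).contMDiffOn fun _ hp => hp
  have hA := A.smooth_form i 0 0
  have hD := contMDiffOn_sectionDeriv hf i
  exact (hA.sub (contMDiffOn_mul contMDiffOn_const
    (contMDiffOn_mul (contMDiffOn_mul (contMDiffOn_star h0) h0) hA))).sub
    ((contMDiffOn_mul (contMDiffOn_star h0) hD).sub (contMDiffOn_mul h0 (contMDiffOn_star hD)))

lemma star_reflectedValue (A : Connection B) (f : B.ι → M → ℂ) {i : B.ι} {x : M}
    (hx : x ∈ B.dom i) (v : TangentSpace 𝓘(ℝ, E) x) :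
    star (reflectedValue A f i x v) = -reflectedValue A f i x v := by
  simp only [reflectedValue, star_sub, star_mul', star_star, star_form A hx v, star_ofNat]
  ring

/-- The differential of a transition function. -/
def transDeriv (B : PrincipalBundle (⊤ : Subgroup (Matrix.unitaryGroup (Fin 1) ℂ)) E M P)
    (i j : B.ι) (x : M) (v : TangentSpace 𝓘(ℝ, E) x) : ℂ :=
  mfderiv 𝓘(ℝ, E) 𝓘(ℝ, ℂ) (fun y => mat (B.trans i j y) 0 0) x v

lemma form_trans_phase (A : Connection B) {i j : B.ι} {x : M} (hi : x ∈ B.dom i)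
    (hj : x ∈ B.dom j) (v : TangentSpace 𝓘(ℝ, E) x) :
    A.form j x v 0 0 = A.form i x v 0 0 + star (phase (B.trans i j x)) * transDeriv B i j x v := by
  have h := congrFun (congrFun (A.form_trans i j x hi hj v) 0) 0
  simp only [Matrix.add_apply, Matrix.mul_apply, Finset.univ_unique, Fin.default_eq_zero,
    Finset.sum_singleton] at h
  refine h.trans ?_
  have h1 : mat (B.trans i j x)⁻¹ 0 0 = star (phase (B.trans i j x)) := phase_inv _
  have h2 : mat (B.trans i j x) 0 0 = phase (B.trans i j x) := rfl
  rw [h1, h2]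
  refine congrArg₂ (· + ·) ?_ rfl
  linear_combination A.form i x v 0 0 * star_phase_mul (B.trans i j x)

lemma sectionDeriv_trans {f : B.ι → M → ℂ} (hf : IsSection B f) {i j : B.ι} {x : M}
    (hi : x ∈ B.dom i) (hj : x ∈ B.dom j) (v : TangentSpace 𝓘(ℝ, E) x) :
    sectionDeriv f i x v = phase (B.trans i j x) * sectionDeriv f j x v +
      f j x * transDeriv B i j x v := by
  have hopen := ((B.isOpen_dom i).inter (B.isOpen_dom j)).mem_nhds ⟨hi, hj⟩
  have h1 : f i =ᶠ[nhds x] (fun y => mat (B.trans i j y) 0 0) * f j :=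
    Filter.eventually_of_mem hopen fun y hy => hf.trans i j y hy.1 hy.2
  have h2 := (mdifferentiableAt_trans B hi hj 0 0).hasMFDerivAt
  have h3 := (((hf.smooth j).contMDiffAt ((B.isOpen_dom j).mem_nhds hj)).mdifferentiableAt
    (by simp)).hasMFDerivAt
  have h4 := ((HasMFDerivAt.mul h2 h3).congr_of_eventuallyEq h1).mfderiv
  exact congrArg (fun L : TangentSpace 𝓘(ℝ, E) x →L[ℝ] ℂ => L v) h4

/-- The correction `f̄ ∇f - f conj(∇f)` is gauge invariant, so the reflected form inherits the
transformation law of `A`. -/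
lemma reflectedValue_trans (A : Connection B) {f : B.ι → M → ℂ} (hf : IsSection B f)
    {i j : B.ι} {x : M} (hi : x ∈ B.dom i) (hj : x ∈ B.dom j) (v : TangentSpace 𝓘(ℝ, E) x) :
    reflectedValue A f j x v = reflectedValue A f i x v +
      star (phase (B.trans i j x)) * transDeriv B i j x v := by
  have hT := star_phase_mul (B.trans i j x)
  have hsA := star_form A hi v
  have hsA' := star_form A hj v
  have hA := form_trans_phase A hi hj v
  simp only [reflectedValue, sectionDeriv_trans hf hi hj v, hf.trans i j x hi hj]
  generalize transDeriv B i j x v = dT at *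
  generalize phase (B.trans i j x) = T at *
  generalize sectionDeriv f j x v = D at *
  generalize f j x = g at *
  generalize A.form i x v 0 0 = α at *
  generalize A.form j x v 0 0 = β at *
  -- That `T̄ dT` is imaginary is read off from the skewness of the two local forms, whose
  -- difference it is.
  have hθ : T * star dT = -(star T * dT) := by
    have : star T * dT = β - α := by rw [hA]; ring
    have h2 := congrArg star this
    rw [star_mul', star_star, star_sub, hsA, hsA'] at h2
    rw [h2, this]
    ring
  simp only [star_mul', star_add, hA]
  linear_combination -(-2 * star g * g * α - star g * D + g * star D) * hT
    - g * star g * hθ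

/-- The connection form of `A` reflected in the section `f`, as a linear map. -/
def reflectedForm (A : Connection B) (f : B.ι → M → ℂ) (i : B.ι) (x : M) :
    TangentSpace 𝓘(ℝ, E) x →ₗ[ℝ] Matrix (Fin 1) (Fin 1) ℂ where
  toFun v := Matrix.of fun _ _ => reflectedValue A f i x v
  map_add' v w := by
    refine matrix_one_ext ?_
    simp only [reflectedValue, map_add, sectionDeriv_add, Matrix.add_apply, Matrix.of_apply,
      star_add]
    ring
  map_smul' r v := by
    refine matrix_one_ext ?_
    simp only [reflectedValue, map_smul, sectionDeriv_smul, Matrix.smul_apply, Matrix.of_apply,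
      star_mul', RingHom.id_apply, Complex.real_smul, RCLike.star_def, Complex.conj_ofReal]
    ring

/-- The connection obtained from `A` by reflection in a section. -/
def reflectedConnection (A : Connection B) {f : B.ι → M → ℂ} (hf : IsSection B f) :
    Connection B where
  form i x := open Classical in if x ∈ B.dom i then reflectedForm A f i x else 0
  form_mem i x hx v := by
    rw [if_pos hx]
    exact mem_lieAlg_top (star_reflectedValue A f hx v)
  smooth_form i k l := by
    refine (contMDiffOn_reflectedValue A hf i).congr fun p hp => ?_
    have h := if_pos (c := p.1 ∈ B.dom i) (h := Classical.dec _) (t := reflectedForm A f i p.1)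
      (e := 0) hp
    exact congrArg (fun L : TangentSpace 𝓘(ℝ, E) p.1 →ₗ[ℝ] Matrix (Fin 1) (Fin 1) ℂ =>
      L p.2 k l) h
  form_trans i j x hi hj v := by
    rw [if_pos hi, if_pos hj]
    refine matrix_one_ext ?_
    refine (reflectedValue_trans A hf hi hj v).trans ?_
    simp only [Matrix.add_apply, Matrix.mul_apply, Finset.univ_unique, Fin.default_eq_zero,
      Finset.sum_singleton]
    have h1 : mat (B.trans i j x)⁻¹ 0 0 = star (phase (B.trans i j x)) := phase_inv _
    have h2 : mat (B.trans i j x) 0 0 = phase (B.trans i j x) := rfl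
    have h3 : reflectedForm A f i x v 0 0 = reflectedValue A f i x v := rfl
    rw [h1, h2, h3]
    refine congrArg₂ (· + ·) ?_ rfl
    linear_combination -reflectedValue A f i x v * star_phase_mul (B.trans i j x)
  form_off i x hx := if_neg hx

lemma reflectedConnection_form (A : Connection B) {f : B.ι → M → ℂ} (hf : IsSection B f)
    {i : B.ι} {x : M} (hx : x ∈ B.dom i) (v : TangentSpace 𝓘(ℝ, E) x) :
    (reflectedConnection A hf).form i x v 0 0 = reflectedValue A f i x v := by
  have h : (reflectedConnection A hf).form i x = reflectedForm A f i x := if_pos hx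
  rw [h]
  rfl

/-- Reflection of horizontal lifts in a section of norm one. -/
lemma IsLiftOn.exists_reflect {A : Connection B} {f : B.ι → M → ℂ} (hf : IsSection B f)
    {c : ℝ → M} {a b : ℝ} (hc : IsPiecewiseDiff E c a b)
    (hone : ∀ t ∈ Icc a b, ∀ i, c t ∈ B.dom i → star (f i (c t)) * f i (c t) = 1)
    {u : ℝ → P} (hu : IsLiftOn A c a b u) :
    ∃ g : ℝ → (⊤ : Subgroup (Matrix.unitaryGroup (Fin 1) ℂ)),
      (∀ t ∈ Icc a b, ∀ i, c t ∈ B.dom i →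
        phase (g t) = (star (phase (B.coord i (u t))) * f i (c t)) ^ 2) ∧
      IsLiftOn (reflectedConnection A hf) c a b fun t => B.act (u t) (g t) := by
  obtain ⟨h1, h2, S, hS, h3⟩ := hu
  obtain ⟨S', hS', h4⟩ := hc.mdifferentiableAt
  -- Let `w` be the coordinate of `u`. The reflected lift should have coordinate `w̄ f²`, the mirror
  -- image of `w` in the line through `f`. So `g = w̄ f² / w = (w̄ f)²`, which has modulus one and
  -- does not depend on the trivialization.
  have hex : ∀ t, ∃ g, t ∈ Icc a b → ∀ i, c t ∈ B.dom i →
      phase g = (star (phase (B.coord i (u t))) * f i (c t)) ^ 2 := fun t => by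
    by_cases ht : t ∈ Icc a b
    · obtain ⟨i, hi⟩ := B.cover (c t)
      obtain ⟨g, hg⟩ := exists_phase_eq
        (w := (star (phase (B.coord i (u t))) * f i (c t)) ^ 2) (by
          rw [star_pow, star_mul', star_star, ← mul_pow, mul_mul_mul_comm, hone t ht i hi,
            mul_comm (phase _), star_phase_mul, one_mul, one_pow])
      refine ⟨g, fun _ j hj => ?_⟩
      rw [hg, B.coord_eq i j (u t) (by rwa [h1 t ht]) (by rwa [h1 t ht]), h1 t ht,
        hf.trans i j _ hi hj, phase_mul, star_mul']
      congr 1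
      linear_combination star (phase (B.coord j (u t))) * f j (c t) *
        star_phase_mul (B.trans i j (c t))
    · exact ⟨1, fun h => absurd h ht⟩
  choose g hg using hex
  have hcoord : ∀ t ∈ Icc a b, ∀ i, c t ∈ B.dom i → ∀ k l,
      mat (B.coord i (B.act (u t) (g t))) k l =
        star (mat (B.coord i (u t)) 0 0) * (f i (c t) * f i (c t)) := fun t ht i hi k l => by
    rw [Fin.fin_one_eq_zero k, Fin.fin_one_eq_zero l, B.coord_act i _ _ (by rwa [h1 t ht])]
    change phase _ = star (phase _) * _
    rw [phase_mul, hg t ht i hi]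
    linear_combination (star (phase (B.coord i (u t))) * f i (c t) * f i (c t)) *
      star_phase_mul (B.coord i (u t))
  refine ⟨g, hg, fun t ht => by rw [B.proj_act, h1 t ht], fun i k l => ?_, S ∪ S', hS.union hS',
    fun t ht i hi k l => ?_⟩
  · have hfc : ContinuousOn (fun t => f i (c t)) (Icc a b ∩ c ⁻¹' B.dom i) :=
      (hf.smooth i).continuousOn.comp (hc.continuousOn.mono inter_subset_left) fun t ht => ht.2
    exact ((h2 i 0 0).star.mul (hfc.mul hfc)).congr fun t ht => hcoord t ht.1 i ht.2 k l
  · have htI : t ∈ Icc a b := Ioo_subset_Icc_self ht.1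
    have hev := eventually_mem_dom hc.continuousOn ht.1 hi
    have hh := h3 t ⟨ht.1, fun h => ht.2 (Or.inl h)⟩ i hi 0 0
    have hd : HasDerivAt (fun s => f i (c s)) (sectionDeriv f i (c t) (velocity c t)) t :=
      hasDerivAt_comp_velocity (((hf.smooth i).contMDiffAt
        ((B.isOpen_dom i).mem_nhds hi)).mdifferentiableAt (by simp))
        (h4 t ⟨ht.1, fun h => ht.2 (Or.inr h)⟩)
    have hzero : star (sectionDeriv f i (c t) (velocity c t)) * f i (c t) +
        star (f i (c t)) * sectionDeriv f i (c t) (velocity c t) = 0 := by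
      refine (hd.star.mul hd).unique ((hasDerivAt_const t (1 : ℂ)).congr_of_eventuallyEq ?_)
      filter_upwards [hev] with s hs using hone s hs.1 i hs.2
    have hmain := hh.star.mul (hd.mul hd)
    have hfun : (fun s => mat (B.coord i (B.act (u s) (g s))) k l) =ᶠ[nhds t]
        fun s => star (mat (B.coord i (u s)) 0 0) * (f i (c s) * f i (c s)) := by
      filter_upwards [hev] with s hs using hcoord s hs.1 i hs.2 k l
    refine (hmain.congr_of_eventuallyEq hfun).congr_deriv ?_
    have hR := reflectedConnection_form A hf hi (velocity c t)
    have hv := hcoord t htI i hi 0 0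
    have hα := star_form A hi (velocity c t)
    have hone' := hone t htI i hi
    rw [Fin.fin_one_eq_zero k, Fin.fin_one_eq_zero l]
    simp only [Matrix.mul_apply, Finset.univ_unique, Fin.default_eq_zero,
      Finset.sum_singleton, hR, hv, star_neg, star_mul', hα, reflectedValue, neg_mul,
      Pi.mul_apply]
    generalize sectionDeriv f i (c t) (velocity c t) = D at *
    generalize f i (c t) = z at *
    generalize mat (B.coord i (u t)) 0 0 = w at *
    generalize A.form i (c t) (velocity c t) 0 0 = α at *
    linear_combination -(2 * α * star w * z * z + 2 * star w * D * z) * hone' +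
      star w * z * z * hzero

lemma holonomy_reflectedConnection {A : Connection B} {f : B.ι → M → ℂ} (hf : IsSection B f)
    {u₀ : P} {γ : PLoop E (B.proj u₀)} (hone : ∀ t ∈ Icc γ.a γ.b, ∀ i, γ.toFun t ∈ B.dom i →
      star (f i (γ.toFun t)) * f i (γ.toFun t) = 1) :
    holonomy (reflectedConnection A hf) u₀ γ = (holonomy A u₀ γ)⁻¹ := by
  obtain ⟨u, hu, hu0, hH⟩ := holonomy_spec IsU1OrSU2.u1 A u₀ γ
  obtain ⟨g, hg, hg'⟩ := hu.exists_reflect hf γ.isPiecewiseDiff hone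
  have ha : γ.a ∈ Icc γ.a γ.b := ⟨le_rfl, γ.le⟩
  have hb : γ.b ∈ Icc γ.a γ.b := ⟨γ.le, le_rfl⟩
  have hub : B.proj (u γ.b) = B.proj u₀ := by rw [hu.1 _ hb, γ.target]
  generalize holonomy A u₀ γ = H at *
  -- The reflected lift, translated to start at `u₀`, has holonomy `g(a) g(b)⁻¹ H`. The section has
  -- the same value at both ends of the loop, so only the coordinates of `u` matter and `g(a) g(b)⁻¹
  -- = H⁻²`.
  have hval : g γ.a * (g γ.b)⁻¹ * H = H⁻¹ := by
    refine phase_injective ?_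
    obtain ⟨i, hi⟩ := B.cover (B.proj u₀)
    have hco : B.coord i u₀ = B.coord i (u γ.b) * H := by
      nth_rewrite 1 [hH]
      exact B.coord_act i _ _ (by rwa [hub])
    have h1 := hg γ.a ha i (by rwa [γ.source])
    have h2 := hg γ.b hb i (by rwa [γ.target])
    have h3 := hone γ.a ha i (by rwa [γ.source])
    rw [hu0, hco, γ.source, phase_mul, star_mul'] at h1
    rw [γ.target] at h2
    rw [γ.source] at h3
    rw [phase_mul, phase_mul, phase_inv, phase_inv, h1, h2, star_pow, star_mul', star_star]
    have h4 := star_phase_mul (B.coord i (u γ.b))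
    have h5 := star_phase_mul H
    generalize phase (B.coord i (u γ.b)) = w at *
    generalize f i (B.proj u₀) = z at *
    generalize phase H = y at *
    calc (star w * star y * z) ^ 2 * (w * star z) ^ 2 * y
        = (star w * w) ^ 2 * (star z * z) ^ 2 * (star y * y) * star y := by ring
      _ = star y := by rw [h3, h4, h5]; ring
  rw [← hval]
  refine holonomy_eq IsU1OrSU2.u1 (hg'.act γ.continuousOn (g γ.a)⁻¹) ?_ ?_
  · simp only [hu0, ← B.act_mul, mul_inv_cancel, B.act_one]
  · simp only [← B.act_mul]
    nth_rewrite 1 [hH]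
    congr 1
    group

/-- For finitely many loops there is a connection with the inverse holonomies. -/
lemma exists_holonomy_eq_inv [FiniteDimensional ℝ E] [T2Space M] (A : Connection B) (u₀ : P)
    {n : ℕ} (γ : Fin n → PLoop E (B.proj u₀)) :
    ∃ A' : Connection B, ∀ k, holonomy A' u₀ (γ k) = (holonomy A u₀ (γ k))⁻¹ := by
  choose m t hmono h0 hm hpc using fun k => (γ k).piecewise_analytic
  -- All arcs of all loops form one family. The extra index `none`, a constant curve at the base
  -- point, covers the initial points, including loops whose partition has no arcs.
  have harc : IsArcFamily E (M := M) (J := Option (Σ k, Fin (m k)))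
      (fun j => j.elim (fun _ => B.proj u₀) fun j => (γ j.1).toFun)
      (fun j => j.elim 0 fun j => t j.1 j.2) (fun j => j.elim 0 fun j => t j.1 (j.2 + 1)) := by
    refine ⟨fun j => ?_⟩
    rcases j with _ | j
    · exact contMDiffOn_const
    · exact (hpc j.1 j.2 j.2.2).of_le le_top
  obtain ⟨f, hf, hone⟩ := exists_section_norm_one (B := B) harc
  refine ⟨reflectedConnection A hf, fun k => holonomy_reflectedConnection hf fun τ hτ i hi => ?_⟩
  rcases hτ.1.eq_or_lt with rfl | hlt
  · rw [(γ k).source] at hi ⊢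
    exact hone none 0 (by simp) i hi
  · obtain ⟨l, hl, hτl⟩ : ∃ l < m k, τ ∈ Icc (t k l) (t k (l + 1)) := by
      by_cases hne : ∀ l ≤ m k, τ ≠ t k l
      · obtain ⟨l, hl, hτl⟩ := exists_mem_Ioo_of_monotone (h0 k ▸ hlt)
          (lt_of_le_of_ne (hm k ▸ hτ.2) (hne _ le_rfl)) hne
        exact ⟨l, hl, Ioo_subset_Icc_self hτl⟩
      · push Not at hne
        obtain ⟨l, hl, rfl⟩ := hne
        rcases l with _ | l
        · exact absurd (h0 k) hlt.ne'
        · exact ⟨l, hl, hmono k (Nat.le_succ l), le_rfl⟩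
    exact hone (some ⟨k, l, hl⟩) τ hτl i hi

end Conjugation

/-! ### The integral transform on a Gelfand spectrum -/

section Gelfand

open WeakDual

variable {𝓐 : Type*} [CommCStarAlgebra 𝓐] {W : Type*}

/-- The complex conjugate of the Gelfand transform. -/
def conjGelfand (a : 𝓐) : C(characterSpace ℂ 𝓐, ℂ) := star (gelfandStarTransform 𝓐 a)

lemma conjGelfand_apply (a : 𝓐) (φ : characterSpace ℂ 𝓐) : conjGelfand a φ = star (φ a) := rfl

lemma conjGelfand_mem_span {w : W → 𝓐} {a : 𝓐} (ha : a ∈ Submodule.span ℂ (range w)) :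
    conjGelfand a ∈ Submodule.span ℂ (range fun T => conjGelfand (w T)) := by
  induction ha using Submodule.span_induction with
  | mem x hx =>
    obtain ⟨T, rfl⟩ := hx
    exact Submodule.subset_span ⟨T, rfl⟩
  | zero => simp [conjGelfand]
  | add x y _ _ hx hy =>
    simp only [conjGelfand, map_add, star_add]
    exact add_mem hx hy
  | smul c x _ hx =>
    simp only [conjGelfand, map_smul, star_smul]
    exact Submodule.smul_mem _ _ hx

/-- The Gelfand transform is onto, hence so is its conjugate, and a continuous surjection carries
dense sets to dense sets. -/
lemma dense_span_conjGelfand {w : W → 𝓐} (hw : Dense (Submodule.span ℂ (range w) : Set 𝓐)) :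
    Dense (Submodule.span ℂ (range fun T => conjGelfand (w T)) :
      Set C(characterSpace ℂ 𝓐, ℂ)) := by
  have hcont : Continuous (conjGelfand (𝓐 := 𝓐)) :=
    continuous_star.comp (gelfandTransform_isometry 𝓐).continuous
  have hsurj : Function.Surjective (conjGelfand (𝓐 := 𝓐)) :=
    star_involutive.surjective.comp (gelfandStarTransform 𝓐).surjective
  refine (hsurj.denseRange.dense_image hcont hw).mono ?_
  rintro _ ⟨a, ha, rfl⟩
  exact conjGelfand_mem_span ha

lemma norm_character_apply_le (φ : characterSpace ℂ 𝓐) (a : 𝓐) : ‖φ a‖ ≤ ‖a‖ :=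
  ((gelfandStarTransform 𝓐 a).norm_coe_le_norm φ).trans_eq
    ((gelfandTransform_isometry 𝓐).norm_map_of_map_zero (map_zero _) a)

lemma conjGelfand_one : conjGelfand (1 : 𝓐) = 1 := by
  rw [conjGelfand, map_one, star_one]

lemma star_conjGelfand (a : 𝓐) : star (conjGelfand a) = conjGelfand (star a) := by
  rw [conjGelfand, conjGelfand, map_star]

/-- Integration of the conjugates of the Gelfand transforms of a bounded family whose span is dense
and self-adjoint and contains the unit. -/
theorem exists_gelfand_transform [MeasurableSpace (characterSpace ℂ 𝓐)]
    [BorelSpace (characterSpace ℂ 𝓐)] (w : W → 𝓐) {C : ℝ} (hC : ∀ T, ‖w T‖ ≤ C)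
    (hdense : Dense (Submodule.span ℂ (range w) : Set 𝓐))
    (hone : (1 : 𝓐) ∈ Submodule.span ℂ (range w))
    (hstar : ∀ T, star (w T) ∈ Submodule.span ℂ (range w)) :
    ∃ L : RegMeas (characterSpace ℂ 𝓐) →L[ℂ] lp (fun _ : W => ℂ) ∞,
      (∀ μ T, L μ T = cintegral (μ : ComplexMeasure (characterSpace ℂ 𝓐))
        fun φ => star (φ (w T))) ∧ Function.Injective L ∧
      BijOn (fun μ => (L μ : W → ℂ)) (PosMeas (characterSpace ℂ 𝓐))
        {ℓ | ∀ (n : ℕ) (c : Fin n → ℂ) (T : Fin n → W),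
          (∀ φ : characterSpace ℂ 𝓐, 0 ≤ ∑ i, c i * star (φ (w (T i)))) →
            0 ≤ ∑ i, c i * ℓ (T i)} :=
  exists_integral_transform (fun T => conjGelfand (w T))
    (fun T φ => by
      rw [conjGelfand_apply, norm_star]
      exact (norm_character_apply_le φ (w T)).trans (hC T))
    (dense_span_conjGelfand hdense) (conjGelfand_one (𝓐 := 𝓐) ▸ conjGelfand_mem_span hone)
    fun T => star_conjGelfand (w T) ▸ conjGelfand_mem_span (hstar T)

end Gelfand

/-! ### Trace identities -/

section Trace

variable {N : ℕ} {G : Subgroup (Matrix.unitaryGroup (Fin N) ℂ)}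

lemma trace_mat_inv (g : G) : (mat g⁻¹).trace = star (mat g).trace := by
  rw [mat_inv, Matrix.trace_conjTranspose]

lemma mat_inv_SU_two (g : SU 2) : mat g⁻¹ = (mat g).adjugate := by
  have hdet : (mat g).det = 1 := mem_SU_iff.1 g.2
  calc mat g⁻¹ = mat g⁻¹ * (mat g * (mat g).adjugate) := by
        rw [Matrix.mul_adjugate, hdet, one_smul, mul_one]
    _ = (mat g).adjugate := by
        rw [← Matrix.mul_assoc, mat_inv, mat_conjTranspose_mul, one_mul]

lemma trace_mat_inv_SU_two (g : SU 2) : (mat g⁻¹).trace = (mat g).trace := by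
  rw [mat_inv_SU_two, Matrix.adjugate_fin_two, Matrix.trace_fin_two, Matrix.trace_fin_two]
  simp [add_comm]

/-- In `SU(2)` Cayley–Hamilton reads `h + h⁻¹ = tr(h) · 1`; multiply by `g` and take traces. -/
lemma trace_mul_trace_SU_two (g h : SU 2) :
    (mat g).trace * (mat h).trace = (mat (g * h)).trace + (mat (g * h⁻¹)).trace := by
  rw [mat_mul, mat_mul, mat_inv_SU_two, Matrix.adjugate_fin_two]
  simp only [Matrix.trace_fin_two, Matrix.mul_apply, Fin.sum_univ_two, Matrix.of_apply,
    Matrix.cons_val', Matrix.cons_val_zero, Matrix.cons_val_one, Matrix.cons_val_fin_one]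
  ring

end Trace

/-! ### Wilson functions, positivity on the spectrum and the loop transform -/

section Wilson

variable {N : ℕ} {G : Subgroup (Matrix.unitaryGroup (Fin N) ℂ)}
  {E : Type*} [NormedAddCommGroup E] [NormedSpace ℝ E]
  {M : Type*} [TopologicalSpace M] [ChartedSpace E M] [IsManifold 𝓘(ℝ, E) ω M] {P : Type*}
  {B : PrincipalBundle G E M P} {u₀ : P}

lemma wilson_apply (γ : PLoop E (B.proj u₀)) (A : Connection B) :
    wilson B u₀ γ A = (1 / (N : ℂ)) * (mat (holonomy A u₀ γ)).trace := rfl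

lemma wilson_const (hG : IsU1OrSU2 G) : wilson B u₀ (PLoop.const (B.proj u₀)) = 1 := by
  have hN : (N : ℂ) ≠ 0 := by cases hG <;> norm_num
  ext A
  rw [wilson_apply, holonomy_const hG, mat_one, Matrix.trace_one, Fintype.card_fin,
    one_div_mul_cancel hN]
  rfl

lemma star_wilson (hG : IsU1OrSU2 G) (γ : PLoop E (B.proj u₀)) :
    star (wilson B u₀ γ) = wilson B u₀ γ.inv := by
  ext A
  rw [BoundedContinuousFunction.star_apply, wilson_apply, wilson_apply, holonomy_inv hG,
    trace_mat_inv]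
  simp

/-- The choice of gauge group matters here: `U(1)` turns products into concatenation, and `SU(2)`
has the two-term trace identity, so linear combinations suffice to express products. -/
lemma wilson_mul_mem_span (hG : IsU1OrSU2 G) (γ δ : PLoop E (B.proj u₀)) :
    wilson B u₀ γ * wilson B u₀ δ ∈ Submodule.span ℂ (wilsonSet B u₀) := by
  cases hG with
  | u1 =>
    have h : wilson B u₀ γ * wilson B u₀ δ = wilson B u₀ (γ.mul δ) := by
      ext A
      rw [BoundedContinuousFunction.mul_apply]
      simp only [wilson_apply]
      rw [holonomy_mul IsU1OrSU2.u1, mat_mul]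
      simp [Matrix.trace_fin_one, Matrix.mul_apply]
    rw [h]
    exact Submodule.subset_span ⟨_, rfl⟩
  | su2 =>
    have h : wilson B u₀ γ * wilson B u₀ δ =
        (1 / 2 : ℂ) • (wilson B u₀ (γ.mul δ) + wilson B u₀ (γ.mul δ.inv)) := by
      ext A
      rw [BoundedContinuousFunction.mul_apply, BoundedContinuousFunction.smul_apply,
        BoundedContinuousFunction.add_apply]
      simp only [wilson_apply]
      rw [holonomy_mul IsU1OrSU2.su2, holonomy_mul IsU1OrSU2.su2, holonomy_inv IsU1OrSU2.su2,
        mul_mul_mul_comm, trace_mul_trace_SU_two]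
      simp only [smul_eq_mul, Nat.cast_ofNat]
      ring
    rw [h]
    exact Submodule.smul_mem _ _ (add_mem (Submodule.subset_span ⟨_, rfl⟩)
      (Submodule.subset_span ⟨_, rfl⟩))

/-- This makes values on single Wilson functions, without their products, enough to determine a
functional on a dense subspace of `Hol`. -/
lemma adjoin_subset_span (hG : IsU1OrSU2 G) :
    (StarAlgebra.adjoin ℂ (wilsonSet B u₀) : Set (BddFun B)) ⊆
      Submodule.span ℂ (wilsonSet B u₀) := by
  intro f hf
  have hone : (1 : BddFun B) ∈ Submodule.span ℂ (wilsonSet B u₀) :=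
    Submodule.subset_span ⟨_, wilson_const hG⟩
  induction hf using StarAlgebra.adjoin_induction with
  | mem x hx => exact Submodule.subset_span hx
  | algebraMap r =>
    rw [Algebra.algebraMap_eq_smul_one]
    exact Submodule.smul_mem _ _ hone
  | add x y _ _ hx hy => exact add_mem hx hy
  | mul x y _ _ hx hy =>
    have h : Submodule.span ℂ (wilsonSet B u₀) * Submodule.span ℂ (wilsonSet B u₀) ≤
        Submodule.span ℂ (wilsonSet B u₀) := by
      rw [Submodule.span_mul_span, Submodule.span_le]
      rintro _ ⟨_, ⟨γ, rfl⟩, _, ⟨δ, rfl⟩, rfl⟩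
      exact wilson_mul_mem_span hG γ δ
    exact h (Submodule.mul_mem_mul hx hy)
  | star x hx' hx =>
    clear hx'
    induction hx using Submodule.span_induction with
    | mem x hx =>
      obtain ⟨γ, rfl⟩ := hx
      exact Submodule.subset_span ⟨_, (star_wilson hG γ).symm⟩
    | zero => rw [star_zero]; exact zero_mem _
    | add x y _ _ hx hy => rw [star_add]; exact add_mem hx hy
    | smul c x _ hx => rw [star_smul]; exact Submodule.smul_mem _ _ hx

/-- A Wilson function as an element of the holonomy C*-algebra. -/
def wilsonElt (T : wilsonSet B u₀) : Hol B u₀ := ⟨T, wilsonSet_subset_Hol B u₀ T.2⟩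

lemma dense_span_wilsonElt (hG : IsU1OrSU2 G) :
    Dense (Submodule.span ℂ (range (wilsonElt (B := B) (u₀ := u₀))) : Set (Hol B u₀)) := by
  intro f
  rw [closure_subtype]
  have himg : ((↑) : Hol B u₀ → BddFun B) ''
      (Submodule.span ℂ (range (wilsonElt (B := B) (u₀ := u₀))) : Set (Hol B u₀)) =
      Submodule.span ℂ (wilsonSet B u₀) := by
    have h := Submodule.map_span ((Hol B u₀).subtype : Hol B u₀ →ₗ[ℂ] BddFun B)
      (range (wilsonElt (B := B) (u₀ := u₀)))
    have h2 : (((Hol B u₀).subtype : Hol B u₀ →ₗ[ℂ] BddFun B) : Hol B u₀ → BddFun B) ''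
        (range (wilsonElt (B := B) (u₀ := u₀))) = wilsonSet B u₀ := by
      rw [← range_comp]
      exact Subtype.range_coe
    rw [h2] at h
    exact congrArg (fun V : Submodule ℂ (BddFun B) => (V : Set (BddFun B))) h
  rw [himg]
  exact closure_mono (adjoin_subset_span hG) f.2

instance : CommCStarAlgebra (Hol B u₀) := {}

/-- The generalized connection given by a connection. -/
def toGenConn (u₀ : P) (A : Connection B) : GenConn B u₀ :=
  WeakDual.CharacterSpace.equivAlgHom.symm
    { toFun := fun f => (f : BddFun B) A
      map_one' := rfl
      map_mul' := fun _ _ => rfl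
      map_zero' := rfl
      map_add' := fun _ _ => rfl
      commutes' := fun _ => by simp [Algebra.algebraMap_eq_smul_one] }

/-- If `f ≥ 0` on connections, then `‖f‖ · 1 - f` has norm at most `‖f‖`. Characters are
contractive, so the real number `Abar f` satisfies `|‖f‖ - Abar f| ≤ ‖f‖` and cannot be negative. -/
lemma genConn_nonneg_iff (f : Hol B u₀) :
    (∀ Abar : GenConn B u₀, 0 ≤ Abar f) ↔ ∀ A, 0 ≤ (f : BddFun B) A := by
  refine ⟨fun h A => h (toGenConn u₀ A), fun h Abar => ?_⟩
  have hstar : star f = f := by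
    refine Subtype.ext (BoundedContinuousFunction.ext fun A => ?_)
    exact (IsSelfAdjoint.of_nonneg (h A)).star_eq
  have him : star (Abar f) = Abar f := by rw [← map_star, hstar]
  obtain ⟨r, hr⟩ := Complex.conj_eq_iff_real.1 him
  have hnorm : ‖(‖f‖ : ℂ) • (1 : Hol B u₀) - f‖ ≤ ‖f‖ := by
    refine (BoundedContinuousFunction.norm_le (norm_nonneg f)).2 fun A => ?_
    obtain ⟨s, hs, hsA⟩ : ∃ s : ℝ, 0 ≤ s ∧ (f : BddFun B) A = s := by
      obtain ⟨s, hs⟩ := Complex.conj_eq_iff_real.1 (IsSelfAdjoint.of_nonneg (h A)).star_eq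
      exact ⟨s, Complex.zero_le_real.1 (hs ▸ h A), hs⟩
    have hle : s ≤ ‖f‖ := by
      have := (f : BddFun B).norm_coe_le_norm A
      rw [hsA, Complex.norm_real, Real.norm_of_nonneg hs] at this
      exact this
    have hval : (((‖f‖ : ℂ) • (1 : Hol B u₀) - f : Hol B u₀) : BddFun B) A =
        ((‖f‖ - s : ℝ) : ℂ) := by
      change (‖f‖ : ℂ) * 1 - (f : BddFun B) A = _
      rw [hsA]
      push_cast
      ring
    refine (congrArg norm hval).le.trans ?_
    rw [Complex.norm_real, Real.norm_of_nonneg (by linarith)]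
    linarith
  have h1 : ‖Abar ((‖f‖ : ℂ) • (1 : Hol B u₀) - f)‖ ≤ ‖f‖ :=
    (norm_character_apply_le _ _).trans hnorm
  rw [map_sub, map_smul, map_one, hr, smul_eq_mul, mul_one, ← Complex.ofReal_sub,
    Complex.norm_real, Real.norm_eq_abs, abs_le] at h1
  rw [hr, Complex.zero_le_real]
  linarith [h1.2]

/-- For finitely many loops there is a connection with the conjugate Wilson functions. -/
lemma exists_wilson_eq_star [FiniteDimensional ℝ E] [T2Space M] (hG : IsU1OrSU2 G)
    (A : Connection B) {n : ℕ} (T : Fin n → wilsonSet B u₀) :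
    ∃ A' : Connection B, ∀ k, (T k : BddFun B) A' = star ((T k : BddFun B) A) := by
  choose γ hγ using fun k => (T k).2
  cases hG with
  | u1 =>
    obtain ⟨A', hA'⟩ := exists_holonomy_eq_inv A u₀ γ
    refine ⟨A', fun k => ?_⟩
    rw [← hγ k, wilson_apply, wilson_apply, hA', trace_mat_inv]
    simp
  | su2 =>
    refine ⟨A, fun k => ?_⟩
    rw [← BoundedContinuousFunction.star_apply, ← hγ k, star_wilson IsU1OrSU2.su2, wilson_apply,
      wilson_apply, holonomy_inv IsU1OrSU2.su2, trace_mat_inv_SU_two]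

lemma sum_evalAt_nonneg_iff {n : ℕ} (c : Fin n → ℂ) (T : Fin n → wilsonSet B u₀) :
    (∀ Abar : GenConn B u₀, 0 ≤ ∑ i, c i * evalAt (T i) Abar) ↔
      ∀ A, 0 ≤ ∑ i, c i * (T i : BddFun B) A := by
  have h := genConn_nonneg_iff (∑ i, c i • wilsonElt (T i))
  have h1 : ∀ Abar : GenConn B u₀, Abar (∑ i, c i • wilsonElt (T i)) =
      ∑ i, c i * evalAt (T i) Abar := fun Abar => by
    rw [map_sum]
    exact Finset.sum_congr rfl fun i _ => map_smul Abar _ _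
  have h2 : ∀ A, ((∑ i, c i • wilsonElt (T i) : Hol B u₀) : BddFun B) A =
      ∑ i, c i * (T i : BddFun B) A := fun A => h1 (toGenConn u₀ A)
  simpa only [h1, h2] using h

/-- This reconciles the conjugate in the transform with its absence in `PosDef`. After conjugating
the coefficients, both sides are tested on connections, and passing from `A` to an `A'` that
conjugates all `T i` simultaneously exchanges the two conditions. -/
lemma sum_star_evalAt_nonneg_iff [FiniteDimensional ℝ E] [T2Space M] (hG : IsU1OrSU2 G) {n : ℕ}
    (c : Fin n → ℂ) (T : Fin n → wilsonSet B u₀) :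
    (∀ Abar : GenConn B u₀, 0 ≤ ∑ i, c i * star (evalAt (T i) Abar)) ↔
      ∀ Abar : GenConn B u₀, 0 ≤ ∑ i, c i * evalAt (T i) Abar := by
  have hconj : ∀ Abar : GenConn B u₀, ∑ i, c i * star (evalAt (T i) Abar) =
      star (∑ i, star (c i) * evalAt (T i) Abar) := fun Abar => by
    simp [star_sum]
  have hconj' : ∀ A, star (∑ i, star (c i) * (T i : BddFun B) A) =
      ∑ i, c i * star ((T i : BddFun B) A) := fun A => by
    simp [star_sum]
  simp only [hconj, star_nonneg_iff]
  rw [sum_evalAt_nonneg_iff, sum_evalAt_nonneg_iff]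
  constructor
  · intro h A
    obtain ⟨A', hA'⟩ := exists_wilson_eq_star hG A T
    have := star_nonneg_iff.2 (h A')
    rw [hconj'] at this
    simpa only [hA', star_star] using this
  · intro h A
    obtain ⟨A', hA'⟩ := exists_wilson_eq_star hG A T
    have := h A'
    simp only [hA'] at this
    rw [← hconj'] at this
    exact star_nonneg_iff.1 this

lemma norm_wilsonElt_le (T : wilsonSet B u₀) : ‖wilsonElt T‖ ≤ ‖(1 / (N : ℂ))‖ * N := by
  obtain ⟨γ, hγ⟩ := T.2
  refine (BoundedContinuousFunction.norm_le
    (mul_nonneg (norm_nonneg _) (Nat.cast_nonneg N))).2 fun A => ?_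
  change ‖(T : BddFun B) A‖ ≤ _
  rw [← hγ]
  exact norm_trace_le _

lemma star_wilsonElt_mem_span (hG : IsU1OrSU2 G) (T : wilsonSet B u₀) :
    star (wilsonElt T) ∈ Submodule.span ℂ (range (wilsonElt (B := B) (u₀ := u₀))) := by
  obtain ⟨γ, hγ⟩ := T.2
  refine Submodule.subset_span ⟨⟨_, γ.inv, rfl⟩, Subtype.ext ?_⟩
  change wilson B u₀ γ.inv = star (T : BddFun B)
  rw [← hγ, star_wilson hG]

theorem exists_loop_transform [FiniteDimensional ℝ E] [T2Space M] (hG : IsU1OrSU2 G)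
    (B : PrincipalBundle G E M P) (u₀ : P) :
    ∃ L : RegMeas (GenConn B u₀) →L[ℂ] lp (fun _ : wilsonSet B u₀ => ℂ) ∞,
      (∀ μ (T : wilsonSet B u₀), L μ T =
        cintegral (μ : ComplexMeasure (GenConn B u₀)) fun Abar => star (evalAt T Abar)) ∧
      Function.Injective L ∧
      BijOn (fun μ => (L μ : wilsonSet B u₀ → ℂ)) (PosMeas (GenConn B u₀)) (PosDef B u₀) := by
  have hone : (1 : Hol B u₀) ∈ Submodule.span ℂ (range (wilsonElt (B := B) (u₀ := u₀))) :=
    Submodule.subset_span ⟨⟨1, _, wilson_const hG⟩, rfl⟩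
  obtain ⟨L, hL, hinj, hbij⟩ := exists_gelfand_transform (wilsonElt (B := B) (u₀ := u₀))
    norm_wilsonElt_le (dense_span_wilsonElt hG) hone (star_wilsonElt_mem_span hG)
  refine ⟨L, hL, hinj, ?_⟩
  -- It remains to identify `PosDef` with positive definiteness relative to the conjugated Wilson
  -- functions.
  convert hbij using 1
  ext ℓ
  refine forall_congr' fun n => forall_congr' fun c => forall_congr' fun T => ?_
  exact imp_congr_left (sum_star_evalAt_nonneg_iff hG c T).symm

end Wilson

end LoopTransform

end

theorem mainTheorem2 {N : ℕ} (G : Subgroup (Matrix.unitaryGroup (Fin N) ℂ))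
    (hG : LoopTransform.IsU1OrSU2 G)
    {E : Type*} [NormedAddCommGroup E] [NormedSpace ℝ E] [FiniteDimensional ℝ E]
    {M : Type*} [TopologicalSpace M] [T2Space M] [SecondCountableTopology M]
    [ChartedSpace E M] [IsManifold 𝓘(ℝ, E) ω M]
    {P : Type*} (B : LoopTransform.PrincipalBundle G E M P) (u₀ : P) :
    ∃ L : LoopTransform.RegMeas (LoopTransform.GenConn B u₀) →L[ℂ]
        lp (fun _ : LoopTransform.wilsonSet B u₀ => ℂ) ∞,
      (∀ μ (T : LoopTransform.wilsonSet B u₀),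
        L μ T = LoopTransform.cintegral (μ : ComplexMeasure (LoopTransform.GenConn B u₀))
          (fun Abar => star (LoopTransform.evalAt T Abar))) ∧
      Function.Injective L ∧
      Set.BijOn (fun μ => (L μ : LoopTransform.wilsonSet B u₀ → ℂ))
        (LoopTransform.PosMeas (LoopTransform.GenConn B u₀)) (LoopTransform.PosDef B u₀) := by
  exact LoopTransform.exists_loop_transform hG B u₀
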